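/- A \emph{constraint graph} is a finite undirected graph $G=(V,E)$, possibly with multiple edges and loops, with edge weights $w:E\to\{1,2\}$; edges of weight $1$ are called red and edges of weight $2$ blue. An \emph{orientation} of $G$ replaces each edge $xy$ by one of the arcs $(x,y)$, $(y,x)$ (a loop at $x$ becomes the arc $(x,x)$), and it is \emph{feasible} if at each vertex the total weight of the entering arcs is at least $2$. In the problem C2E (configuration-to-edge) one is given a constraint graph $G$, a feasible orientation $A_{\mathrm{ini}}$ of $G$ and an edge $e$ of $G$, and asks whether $A_{\mathrm{ini}}$ can be transformed, by reversing one arc at a time so that all intermediate orientations are feasible, into a feasible orientation $A_{\mathrm{tar}}$ in which the direction of $e$ is different from that in $A_{\mathrm{ini}}$. A vertex is an \emph{AND vertex} if it is incident to exactly one blue and exactly two red edges, and an \emph{OR vertex} if it is incident to exactly three blue edges and no red edge (loops are counted twice); an \emph{AND/OR graph} is a constraint graph in which each vertex is an AND or an OR vertex. The size of an instance is $|V|+|E|$. A parameterized problem with parameter $k$ \emph{admits a kernel of size $O(k)$} if there are a function $g:\mathbb{N}\to\mathbb{N}$ with $g(k)=O(k)$ as $k\to\infty$ and a polynomial-time algorithm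 that maps every instance with parameter $k$ to an equivalent instance of the same problem whose size and parameter are at most $g(k)$. \textbf{Corollary.} (1) C2E, parameterized by the number $k$ of red edges of the constraint graph, admits a kernel of size $O(k)$. (2) C2E on AND/OR graphs, parameterized by the number $k'$ of AND vertices, admits a kernel of size $O(k')$. -/

import Mathlib

/-! ## Constraint graphs and their orientations -/

namespace NCL

/-- Red edges have weight one, blue edges have weight two. -/
inductive Color
  | red
  | blue
  deriving DecidableEq

/-- The weight of an edge of the given color. -/
def Color.weight : Color → ℕ
  | .red => 1
  | .blue => 2

/-- A constraint graph: an undirected graph with vertex set `V` and edge set `E`, multiple edges and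
loops allowed, in which every edge has weight one (red) or two (blue). -/
structure ConstraintGraph (V E : Type) where
  /-- the unordered pair of end vertices of an edge -/
  ends : E → Sym2 V
  /-- the color (weight) of an edge -/
  color : E → Color

/-- An orientation replaces every edge by one arc `(tail, head)` with the same end vertices.
(So a loop at `x` can only become the arc `(x, x)`.) -/
@[ext]
structure Orientation {V E : Type} (G : ConstraintGraph V E) where
  /-- the arc `(tail, head)` that replaces an edge -/
  arc : E → V × V
  /-- the arc has the same end vertices as the edge -/
  arc_ends : ∀ e, s((arc e).1, (arc e).2) = G.ends e

section

variable {V E : Type} [Fintype V] [Fintype E] [DecidableEq V]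

namespace Orientation

variable {G : ConstraintGraph V E}

/-- The number of arcs of color `c` that enter `v`. -/
def indegree (A : Orientation G) (c : Color) (v : V) : ℕ :=
  (Finset.univ.filter fun e : E => G.color e = c ∧ (A.arc e).2 = v).card

/-- An orientation is feasible (a configuration) if every vertex has in-weight at least two. -/
def Feasible (A : Orientation G) : Prop :=
  ∀ v : V, 2 ≤ Color.red.weight * A.indegree .red v + Color.blue.weight * A.indegree .blue v

/-- `A ↔ B`: the orientations are equal or differ by the reversal of a single arc. -/
def Adj (A B : Orientation G) : Prop :=
  A = B ∨ ∃ e : E, B.arc e = (A.arc e).swap ∧ ∀ e', e' ≠ e → B.arc e' = A.arc e'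

/-- There is a reconfiguration sequence of feasible orientations from `A` to `B`. -/
def Reachable (A B : Orientation G) : Prop :=
  Relation.ReflTransGen (fun X Y : Orientation G => X.Feasible ∧ Y.Feasible ∧ X.Adj Y) A B

end Orientation

namespace ConstraintGraph

/-- The number of edges of color `c` at `v`, where a loop counts twice. -/
def degree (G : ConstraintGraph V E) (c : Color) (v : V) : ℕ :=
  (Finset.univ.filter fun e : E => G.color e = c ∧ v ∈ G.ends e).card +
    (Finset.univ.filter fun e : E => G.color e = c ∧ G.ends e = s(v, v)).card

/-- An AND vertex has degree three, with exactly one blue edge (and so two red edges). -/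
def IsAnd (G : ConstraintGraph V E) (v : V) : Prop :=
  G.degree .blue v = 1 ∧ G.degree .red v = 2

/-- An OR vertex has degree three, with three blue edges. -/
def IsOr (G : ConstraintGraph V E) (v : V) : Prop :=
  G.degree .blue v = 3 ∧ G.degree .red v = 0

/-- AND/OR graphs: every vertex is an AND vertex or an OR vertex. -/
def IsAndOr (G : ConstraintGraph V E) : Prop :=
  ∀ v : V, G.IsAnd v ∨ G.IsOr v

/-- The number of red edges. -/
def numRed (G : ConstraintGraph V E) : ℕ :=
  (Finset.univ.filter fun e : E => G.color e = .red).card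

/-- The number of AND vertices. -/
noncomputable def numAnd (G : ConstraintGraph V E) : ℕ :=
  Set.ncard {v : V | G.IsAnd v}

end ConstraintGraph

end

/-! ## A programming language with a time measure -/

/-- The data that programs work on: binary trees. -/
inductive Data
  | nil
  | cons (a b : Data)

namespace Data

/-- The number of nodes. -/
def size : Data → ℕ
  | nil => 1
  | cons a b => a.size + b.size + 1

/-- The left subtree (`nil` for the empty tree). -/
def fst : Data → Data
  | nil => nil
  | cons a _ => a

/-- The right subtree (`nil` for the empty tree). -/
def snd : Data → Data
  | nil => nil
  | cons _ b => b

/-- Natural numbers in unary. -/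
def ofNat : ℕ → Data
  | 0 => nil
  | n + 1 => cons nil (ofNat n)

/-- Lists of data. -/
def ofList : List Data → Data
  | [] => nil
  | a :: l => cons a (ofList l)

/-- The two colors. -/
def ofColor : Color → Data
  | .red => nil
  | .blue => cons nil nil

end Data

/-- While-programs over binary trees; each of them maps an input tree to an output tree. -/
inductive Prog
  | id
  | nil
  | fst
  | snd
  | pair (p q : Prog)
  | comp (q p : Prog)
  | ite (c p q : Prog)
  | while (c p : Prog)

/-- `p.Run x y t`: on input `x`, the program `p` halts with output `y` after time `t`.  Every
execution of an instruction costs the size of the tree to which it is applied, in addition to the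
time spent in its subprograms.  Hence the running time bounds the size of every tree that occurs,
and it agrees with the running time of Turing machines up to a polynomial. -/
inductive Prog.Run : Prog → Data → Data → ℕ → Prop
  | id (x : Data) : Run .id x x x.size
  | nil (x : Data) : Run .nil x .nil x.size
  | fst (x : Data) : Run .fst x x.fst x.size
  | snd (x : Data) : Run .snd x x.snd x.size
  | pair {p q : Prog} {x y z : Data} {s t : ℕ} :
      Run p x y s → Run q x z t → Run (.pair p q) x (.cons y z) (x.size + s + t)
  | comp {q p : Prog} {x y z : Data} {s t : ℕ} :
      Run p x y s → Run q y z t → Run (.comp q p) x z (x.size + s + t)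
  | ite_true {c p q : Prog} {x a b z : Data} {s t : ℕ} :
      Run c x (.cons a b) s → Run p x z t → Run (.ite c p q) x z (x.size + s + t)
  | ite_false {c p q : Prog} {x z : Data} {s t : ℕ} :
      Run c x .nil s → Run q x z t → Run (.ite c p q) x z (x.size + s + t)
  | while_stop {c p : Prog} {x : Data} {s : ℕ} :
      Run c x .nil s → Run (.while c p) x x (x.size + s)
  | while_step {c p : Prog} {x a b y z : Data} {s t u : ℕ} :
      Run c x (.cons a b) s → Run p x y t → Run (.while c p) y z u →
        Run (.while c p) x z (x.size + s + t + u)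

/-- `f` is computed by a program in time polynomial in the size of the encoded input. -/
def PolyTime {α β : Type} (encα : α → Data) (encβ : β → Data) (f : α → β) : Prop :=
  ∃ (p : Prog) (T : Polynomial ℕ), ∀ a : α, ∃ t : ℕ,
    t ≤ T.eval (encα a).size ∧ p.Run (encα a) (encβ (f a)) t

/-! ## Parameterized problems and kernels -/

/-- A parameterized decision problem, with an encoding of its instances by data. -/
structure ParamProblem where
  /-- the instances -/
  Inst : Type
  /-- the encoding of instances that algorithms work on -/
  enc : Inst → Data
  /-- the yes-instances -/
  Yes : Inst → Prop
  /-- the parameter -/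
  param : Inst → ℕ
  /-- the size in which kernels are measured -/
  size : Inst → ℕ

/-- The problem admits a kernel of size `O(k)`, where `k` is the parameter: a polynomial-time
algorithm turns each instance into an equivalent instance of the same problem, whose size and
parameter are at most `g(k)` for a function `g(k) = O(k)`. -/
def ParamProblem.AdmitsLinearKernel (P : ParamProblem) : Prop :=
  ∃ f : P.Inst → P.Inst,
    PolyTime P.enc P.enc f ∧
    (∀ I, P.Yes (f I) ↔ P.Yes I) ∧
    ∃ g : ℕ → ℕ,
      (fun k : ℕ => (g k : ℝ)) =O[Filter.atTop] (fun k : ℕ => (k : ℝ)) ∧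
      ∀ I, P.size (f I) ≤ g (P.param I) ∧ P.param (f I) ≤ g (P.param I)

/-! ## The problem C2E -/

/-- An instance `(G, A_ini, e)` of C2E: a finite constraint graph (with vertices `0, …, n - 1` and
edges `0, …, m - 1`), a feasible orientation, and an edge. -/
structure C2EInstance where
  /-- the number of vertices -/
  n : ℕ
  /-- the number of edges -/
  m : ℕ
  /-- the constraint graph -/
  G : ConstraintGraph (Fin n) (Fin m)
  /-- the initial orientation -/
  Aini : Orientation G
  /-- the initial orientation is feasible -/
  feasible : Aini.Feasible
  /-- the edge to be reversed -/
  e : Fin m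

namespace C2EInstance

/-- The question of C2E: can one reach a feasible orientation in which the direction of `e` is
different? -/
def Yes (I : C2EInstance) : Prop :=
  ∃ Atar : Orientation I.G, Atar.Feasible ∧ I.Aini.Reachable Atar ∧
    Atar.arc I.e ≠ I.Aini.arc I.e

/-- The number of vertices plus the number of edges. -/
def size (I : C2EInstance) : ℕ := I.n + I.m

/-- The encoding of an instance: the number of vertices, the edge `e`, and the list of all edges,
each with its color and with its arc (hence also its ends).  As all numbers are less than or equal
to `n` or `m`, the size of the encoding is bounded by a polynomial in `n + m`. -/
def enc (I : C2EInstance) : Data :=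
  .cons (.ofNat I.n) <| .cons (.ofNat I.e) <| .ofList <| List.ofFn fun i : Fin I.m =>
    .cons (.ofColor (I.G.color i)) (.cons (.ofNat (I.Aini.arc i).1) (.ofNat (I.Aini.arc i).2))

end C2EInstance

/-- C2E parameterized by the number of red edges. -/
def C2EByRedEdges : ParamProblem where
  Inst := C2EInstance
  enc := C2EInstance.enc
  Yes := C2EInstance.Yes
  param I := I.G.numRed
  size := C2EInstance.size

/-- C2E on AND/OR graphs parameterized by the number of AND vertices. -/
noncomputable def C2EAndOrByAndVertices : ParamProblem where
  Inst := {I : C2EInstance // I.G.IsAndOr}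
  enc I := I.1.enc
  Yes I := I.1.Yes
  param I := I.1.G.numAnd
  size I := I.1.size

end NCL

namespace NCL

/-! ## Polynomial-time functions -/

/-! Call `e` and the red edges special and the other blue edges ordinary; the ends of special edges
are terminals. A component of the ordinary graph is deficient if it has fewer edges than vertices.
In a feasible orientation some vertex of a deficient component is entered by no ordinary arc, so its
demand is met by special arcs alone. This is the only restriction that the ordinary edges impose:
starting from a feasible orientation, a special arc can be reversed, after suitable reversals of
ordinary arcs, if and only if each deficient component has a vertex whose demand the special arcs
meet both before and after the reversal (`changeable_iff_rooted`).

Necessity is the pigeonhole principle (`Components.exists_inDeg_eq_zero`): the ordinary arcs do not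
change during the reversal, so one vertex serves for both orientations. For sufficiency, ordinary
arcs are reversed along directed walks until they enter every vertex that the special arcs do not
serve on both sides (`exists_walk_surplus`, `exists_uncovered_lt_of_walk`).

Hence the ordinary graph can be exchanged for any blue graph whose deficient components are hit by
the same sets of terminals, as long as the initial orientation stays feasible (`changeable_congr`).
For general graphs, each component with terminals becomes a star on its terminals, with loops at the
center if it is not deficient; as there are at most `k + 1` special edges, the result has linear
size. In AND/OR graphs the degrees must survive. There the deficient components are kept, and a
terminal in any other component receives a blue loop, or a blue edge to a new vertex with a loop.
The kept components are small because they have at most as many edges as vertices although their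
nonterminals have degree three (`card_filter_isDef_le`), and red edges are at most as many as AND
vertices (`numRed_le_numAnd`).

For the running time, `Poly` is closed under composition and under folds over lists whose
accumulators stay polynomially small (`Poly.foldl`, `Poly.foldr`), and both replacements, including
the computation of the components, are expressed by such list functions. -/

lemma polynomial_eval_mono (p : Polynomial ℕ) {a b : ℕ} (h : a ≤ b) : p.eval a ≤ p.eval b := by
  rw [Polynomial.eval_eq_sum_range, Polynomial.eval_eq_sum_range]
  gcongr

lemma Data.one_le_size (x : Data) : 1 ≤ x.size := by
  cases x <;> simp [Data.size]

/-- Every rule charges at least the size of its input. For `pair`, this charge pays for the new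
root; in the other compound rules the output is that of a subprogram or, when a loop stops, the
input itself. -/
lemma Prog.Run.size_le {p : Prog} {x y : Data} {t : ℕ} (h : p.Run x y t) : y.size ≤ t := by
  induction h with
  | id x => exact le_rfl
  | nil x => exact x.one_le_size
  | fst x => cases x <;> simp [Data.size, Data.fst]; omega
  | snd x => cases x <;> simp [Data.size, Data.snd]; omega
  | @pair p q x => have := x.one_le_size; simp only [Data.size]; omega
  | _ => omega

/-- Types whose elements are encoded by data. -/
class Encoded (α : Type) where
  /-- the encoding -/
  enc : α → Data

open Encoded

instance : Encoded ℕ := ⟨Data.ofNat⟩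
instance : Encoded Color := ⟨Data.ofColor⟩
instance : Encoded Unit := ⟨fun _ => .nil⟩
instance : Encoded Bool := ⟨fun b => if b then .cons .nil .nil else .nil⟩
instance {α β : Type} [Encoded α] [Encoded β] : Encoded (α × β) := ⟨fun p => .cons (enc p.1) (enc p.2)⟩
instance {α : Type} [Encoded α] : Encoded (List α) := ⟨fun l => .ofList (l.map enc)⟩

/-- The size of the encoding. -/
def esize {α : Type} [Encoded α] (a : α) : ℕ := (enc a).size

/-- The function is computed in polynomial time. -/
def Poly {α β : Type} [Encoded α] [Encoded β] (f : α → β) : Prop := PolyTime enc enc f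

section

variable {α β γ δ : Type} [Encoded α] [Encoded β] [Encoded γ] [Encoded δ]

lemma one_le_esize (a : α) : 1 ≤ esize a := Data.one_le_size _

@[simp] lemma esize_prod (p : α × β) : esize p = esize p.1 + esize p.2 + 1 := rfl
@[simp] lemma esize_list_nil : esize ([] : List α) = 1 := rfl
@[simp] lemma esize_list_cons (a : α) (l : List α) : esize (a :: l) = esize a + esize l + 1 := rfl
@[simp] lemma esize_unit (a : Unit) : esize a = 1 := rfl

lemma esize_nat (n : ℕ) : esize n = 2 * n + 1 := by
  induction n with
  | zero => rfl
  | succ n ih =>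
    have : esize (n + 1) = 1 + esize n + 1 := rfl
    omega

lemma length_lt_esize (l : List α) : l.length < esize l := by
  induction l with
  | nil => simp
  | cons a l ih => simp; omega

lemma esize_append (l l' : List α) : esize (l ++ l') + 1 = esize l + esize l' := by
  induction l with
  | nil => simp; omega
  | cons a l ih => simp; omega

lemma esize_reverse (l : List α) : esize l.reverse = esize l := by
  induction l with
  | nil => simp
  | cons a l ih => have := esize_append l.reverse [a]; simp at *; omega

lemma esize_le_of_mem {a : α} {l : List α} (h : a ∈ l) : esize a < esize l := by
  induction l with
  | nil => simp at h
  | cons b l ih =>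
    rcases List.mem_cons.1 h with rfl | h
    · simp only [esize_list_cons]; omega
    · have := ih h; simp; omega

lemma esize_list_le {l : List α} {B : ℕ} (h : ∀ a ∈ l, esize a ≤ B) :
    esize l ≤ l.length * (B + 1) + 1 := by
  induction l with
  | nil => simp
  | cons a l ih =>
    have := ih fun b hb => h b (by simp [hb])
    have := h a (by simp)
    simp only [esize_list_cons, List.length_cons]
    ring_nf at *
    omega

/-! ### Closure properties of polynomial-time functions -/

namespace Poly

/-- Time bounds sizes, so intermediate results can be fed into the time bounds of later programs. -/
lemma exists_esize_le {f : α → β} (hf : Poly f) :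
    ∃ T : Polynomial ℕ, ∀ a, esize (f a) ≤ T.eval (esize a) := by
  obtain ⟨p, T, h⟩ := hf
  refine ⟨T, fun a => ?_⟩
  obtain ⟨t, ht, hr⟩ := h a
  exact hr.size_le.trans ht

lemma id : Poly fun a : α => a :=
  ⟨.id, .X, fun a => ⟨_, by simp, .id _⟩⟩

lemma comp {g : β → γ} {f : α → β} (hg : Poly g) (hf : Poly f) : Poly fun a => g (f a) := by
  obtain ⟨p, S, hp⟩ := hf
  obtain ⟨q, T, hq⟩ := hg
  refine ⟨.comp q p, .X + S + T.comp S, fun a => ?_⟩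
  obtain ⟨s, hs, hps⟩ := hp a
  obtain ⟨t, ht, hqt⟩ := hq (f a)
  refine ⟨_, ?_, .comp hps hqt⟩
  have := polynomial_eval_mono T (hps.size_le.trans hs)
  simp only [Polynomial.eval_add, Polynomial.eval_X, Polynomial.eval_comp]
  omega

lemma pair {f : α → β} {g : α → γ} (hf : Poly f) (hg : Poly g) : Poly fun a => (f a, g a) := by
  obtain ⟨p, S, hp⟩ := hf
  obtain ⟨q, T, hq⟩ := hg
  refine ⟨.pair p q, .X + S + T, fun a => ?_⟩
  obtain ⟨s, hs, hps⟩ := hp a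
  obtain ⟨t, ht, hqt⟩ := hq a
  refine ⟨_, ?_, .pair hps hqt⟩
  simp only [Polynomial.eval_add, Polynomial.eval_X]
  omega

lemma fst {f : α → β × γ} (hf : Poly f) : Poly fun a => (f a).1 :=
  comp (g := Prod.fst) ⟨.fst, .X, fun _ => ⟨_, by simp, .fst _⟩⟩ hf

lemma snd {f : α → β × γ} (hf : Poly f) : Poly fun a => (f a).2 :=
  comp (g := Prod.snd) ⟨.snd, .X, fun _ => ⟨_, by simp, .snd _⟩⟩ hf

lemma nil : Poly fun _ : α => ([] : List β) :=
  ⟨.nil, .X, fun _ => ⟨_, by simp, .nil _⟩⟩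

/-- Functions with equal values have equal programs. -/
lemma of_enc_eq {α' β' : Type} [Encoded α'] [Encoded β'] {f : α → β} (hf : Poly f) {g : α' → β'}
    (i : α' → α) (hi : ∀ a, enc (i a) = enc a) (h : ∀ a, enc (g a) = enc (f (i a))) : Poly g := by
  obtain ⟨p, T, hp⟩ := hf
  refine ⟨p, T, fun a => ?_⟩
  have := hp (i a)
  rwa [← h, hi] at this

lemma cons {f : α → β} {g : α → List β} (hf : Poly f) (hg : Poly g) : Poly fun a => f a :: g a :=
  of_enc_eq (pair hf hg) (fun a => a) (fun _ => rfl) fun _ => rfl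

lemma unit : Poly fun _ : α => () :=
  of_enc_eq (nil (β := Unit)) (fun a : α => a) (fun _ => rfl) fun _ => rfl

lemma zero : Poly fun _ : α => 0 :=
  of_enc_eq (nil (β := Unit)) (fun a : α => a) (fun _ => rfl) fun _ => rfl

lemma succ {f : α → ℕ} (hf : Poly f) : Poly fun a => f a + 1 :=
  of_enc_eq (pair unit hf) (fun a => a) (fun _ => rfl) fun _ => rfl

lemma false : Poly fun _ : α => Bool.false :=
  of_enc_eq (nil (β := Unit)) (fun a : α => a) (fun _ => rfl) fun _ => rfl

lemma true : Poly fun _ : α => Bool.true :=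
  of_enc_eq (pair unit unit) (fun a : α => a) (fun _ => rfl) fun _ => rfl

lemma blue : Poly fun _ : α => Color.blue :=
  of_enc_eq (pair unit unit) (fun a : α => a) (fun _ => rfl) fun _ => rfl

lemma tail {f : α → List β} (hf : Poly f) : Poly fun a => (f a).tail :=
  comp (g := List.tail)
    ⟨.snd, .X, fun l => ⟨(enc l).size, by simp, by cases l <;> exact .snd _⟩⟩ hf

lemma pred {f : α → ℕ} (hf : Poly f) : Poly fun a => f a - 1 :=
  comp (g := fun n => n - 1)
    ⟨.snd, .X, fun l => ⟨(enc l).size, by simp, by cases l <;> exact .snd _⟩⟩ hf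

/-- The default value `0` is encoded by the empty tree, on which `Prog.fst` returns the empty tree.
-/
lemma headD_nat {f : α → List ℕ} (hf : Poly f) : Poly fun a => (f a).headD 0 :=
  comp (g := fun l => List.headD l 0)
    ⟨.fst, .X, fun l => ⟨(enc l).size, by simp, by cases l <;> exact .fst _⟩⟩ hf

/-- A unary number and a list of that many units have the same encoding. Loops with a counter
thereby become folds over lists. -/
lemma replicate {f : α → ℕ} (hf : Poly f) : Poly fun a => List.replicate (f a) () := by
  refine of_enc_eq hf (fun a => a) (fun _ => rfl) fun a => ?_
  induction f a with
  | zero => rfl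
  | succ n ih =>
    exact congrArg (Data.cons .nil) ih

lemma cond {b : α → Bool} {f g : α → β} (hb : Poly b) (hf : Poly f) (hg : Poly g) :
    Poly fun a => if b a then f a else g a := by
  obtain ⟨c, R, hc⟩ := hb
  obtain ⟨p, S, hp⟩ := hf
  obtain ⟨q, T, hq⟩ := hg
  refine ⟨.ite c p q, .X + R + S + T, fun a => ?_⟩
  obtain ⟨r, hr, hcr⟩ := hc a
  obtain ⟨s, hs, hps⟩ := hp a
  obtain ⟨t, ht, hqt⟩ := hq a
  simp only [Polynomial.eval_add, Polynomial.eval_X]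
  cases h : b a with
  | false =>
    rw [h] at hcr
    exact ⟨_, by omega, .ite_false hcr hqt⟩
  | true =>
    rw [h] at hcr
    exact ⟨_, by omega, .ite_true hcr hps⟩

/-- Colors and Booleans are encoded by the same two trees. -/
lemma isBlue {f : α → Color} (hf : Poly f) : Poly fun a => decide (f a = .blue) :=
  of_enc_eq hf (fun a => a) (fun _ => rfl) fun a => by cases f a <;> rfl

lemma isNil {f : α → List β} (hf : Poly f) : Poly fun a => (f a).isEmpty :=
  comp (g := List.isEmpty) (by
    obtain ⟨p, T, hp⟩ := (true : Poly fun _ : List β => Bool.true)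
    refine ⟨.ite .id .nil p, .X + .X + .X + T, fun l => ?_⟩
    obtain ⟨t, ht, hpt⟩ := hp l
    simp only [Polynomial.eval_add, Polynomial.eval_X]
    cases l with
    | nil => exact ⟨_, by omega, .ite_false (.id _) hpt⟩
    | cons a l => exact ⟨_, by omega, .ite_true (.id _) (.nil _)⟩) hf

/-- The loop body that passes the head of a list to a program. -/
def foldBody (p : Prog) : Prog :=
  .pair (.comp .snd .fst) (.pair (.comp p (.pair (.comp .snd .snd)
    (.pair (.comp .fst .snd) (.comp .fst .fst)))) (.comp .snd .snd))

/-- The loop state is the remaining list paired with accumulator and context. The body consists of a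
fixed number of instructions besides `p`, each applied to a tree of size at most `W`. -/
lemma run_foldBody {p : Prog} {A L B B' C : Data} {t : ℕ} {W : ℕ}
    (h : p.Run (.cons C (.cons B A)) B' t) (hW : (Data.cons (.cons A L) (.cons B C)).size ≤ W) :
    ∃ s ≤ 30 * W + t,
      (foldBody p).Run (.cons (.cons A L) (.cons B C)) (.cons L (.cons B' C)) s := by
  refine ⟨_, ?_, .pair (.comp (.fst _) (.snd _)) (.pair (.comp (.pair (.comp (.snd _) (.snd _))
    (.pair (.comp (.snd _) (.fst _)) (.comp (.fst _) (.fst _)))) h) (.comp (.snd _) (.snd _)))⟩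
  simp only [Data.size, Data.fst, Data.snd] at *
  omega

/-- Each round costs at most `30 * W + T.eval W` for the body and `2 * W` for the loop and its test;
the extra round is the test that stops the loop. -/
lemma run_fold {p : Prog} {T : Polynomial ℕ} {step : γ → β → α → β}
    (hp : ∀ x : γ × β × α, ∃ t ≤ T.eval (esize x), p.Run (enc x) (enc (step x.1 x.2.1 x.2.2)) t)
    (c : γ) {B W : ℕ} (l : List α) (b : β)
    (hB : ∀ l', l' <+: l → esize (l'.foldl (step c) b) ≤ B) (hW : esize l + B + esize c + 2 ≤ W) :
    ∃ t ≤ (l.length + 1) * (32 * W + T.eval W),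
      (Prog.while .fst (foldBody p)).Run (.cons (enc l) (.cons (enc b) (enc c)))
        (.cons .nil (.cons (enc (l.foldl (step c) b)) (enc c))) t := by
  induction l generalizing b with
  | nil =>
    refine ⟨_, ?_, Prog.Run.while_stop (.fst _)⟩
    have := hB [] List.prefix_rfl
    simp only [List.foldl_nil, esize, enc, List.map_nil, Data.ofList, Data.size, List.length_nil] at *
    omega
  | cons a l ih =>
    have h0 := hB [] (List.nil_prefix)
    obtain ⟨t, ht, hr⟩ := hp (c, b, a)
    obtain ⟨u, hu, hs⟩ := run_foldBody (L := enc l) (W := W) hr (by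
      simp only [List.foldl_nil, esize, Data.size] at *
      simp only [enc, List.map_cons, Data.ofList, Data.size] at *
      omega)
    obtain ⟨v, hv, hw⟩ := ih (step c b a)
      (fun l' hl' => hB (a :: l') (by simpa using hl')) (by simp at hW; omega)
    refine ⟨_, ?_, .while_step (.fst _) hs hw⟩
    have hT := polynomial_eval_mono T (a := esize (c, b, a)) (b := W) (by
      simp only [List.foldl_nil, esize_prod, esize_list_cons] at *
      have := one_le_esize l
      omega)
    have hsz : (Data.cons (enc (a :: l)) (.cons (enc b) (enc c))).size ≤ W := by
      simp only [List.foldl_nil, esize, Data.size] at *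
      omega
    simp only [List.length_cons]
    have h1 : (l.length + 1 + 1) * (32 * W + T.eval W) =
      (l.length + 1) * (32 * W + T.eval W) + (32 * W + T.eval W) := by ring
    rw [h1]
    omega

/-- Folding a polynomial-time function over a list, if all intermediate results are small. -/
lemma foldl {l : γ → List α} {init : γ → β} {step : γ → β → α → β}
    (hs : Poly fun p : γ × β × α => step p.1 p.2.1 p.2.2) (hl : Poly l) (hi : Poly init)
    (hB : ∃ Q : Polynomial ℕ, ∀ c l', l' <+: l c →
      esize (l'.foldl (step c) (init c)) ≤ Q.eval (esize c)) :
    Poly fun c => (l c).foldl (step c) (init c) := by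
  obtain ⟨p, T, hp⟩ := hs
  obtain ⟨q, S, hq⟩ := hl.pair (hi.pair id)
  obtain ⟨R, hR⟩ := hl.exists_esize_le
  obtain ⟨Q, hQ⟩ := hB
  -- Bounds the loop state: the list, the accumulator, the context and the two nodes that join them.
  let W : Polynomial ℕ := R + Q + .X + 2
  refine ⟨.comp .fst (.comp .snd (.comp (.while .fst (foldBody p)) q)),
    100 * (.X + S + Q + W) + (R + 1) * (32 * W + T.comp W), fun c => ?_⟩
  obtain ⟨s, hs, hqs⟩ := hq c
  obtain ⟨t, ht, hpt⟩ := run_fold hp c (W := W.eval (esize c)) (l c) (init c) (hQ c)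
    (by have := hR c; simp [W]; omega)
  refine ⟨_, ?_, .comp (.comp (.comp hqs hpt) (.snd _)) (.fst _)⟩
  have h1 := hR c
  have h2 := hQ c _ List.prefix_rfl
  have h3 := length_lt_esize (l c)
  have h4 : ((l c).length + 1) * (32 * W.eval (esize c) + T.eval (W.eval (esize c))) ≤
      (R.eval (esize c) + 1) * (32 * W.eval (esize c) + T.eval (W.eval (esize c))) := by
    gcongr; omega
  have h5 : W.eval (esize c) = R.eval (esize c) + Q.eval (esize c) + esize c + 2 := by simp [W]
  simp only [Polynomial.eval_add, Polynomial.eval_mul, Polynomial.eval_X, Polynomial.eval_comp,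
    Polynomial.eval_ofNat, Polynomial.eval_one, Data.size, Data.snd] at *
  simp only [esize] at *
  omega

lemma reverse {l : γ → List α} (hl : Poly l) : Poly fun c => (l c).reverse := by
  have : (fun c => (l c).reverse) = fun c => (l c).foldl (fun acc a => a :: acc) [] := by
    funext c
    simp
  rw [this]
  refine foldl (step := fun _ acc a => a :: acc) (cons id.snd.snd id.snd.fst) hl nil ?_
  obtain ⟨R, hR⟩ := hl.exists_esize_le
  refine ⟨R, fun c l' hl' => ?_⟩
  refine le_trans ?_ (hR c)
  obtain ⟨l'', h⟩ := hl'
  have := esize_append l' l''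
  have := one_le_esize l''
  have h2 : l'.foldl (fun acc a => a :: acc) [] = l'.reverse := by simp
  rw [h2, esize_reverse, ← h]
  omega

/-- Folding a polynomial-time function that increases the size of the accumulator by an amount
independent of the accumulator. -/
lemma foldr {l : γ → List α} {init : γ → β} {step : γ → α → β → β}
    (hs : Poly fun p : γ × α × β => step p.1 p.2.1 p.2.2) (hl : Poly l) (hi : Poly init)
    (hB : ∃ Q : Polynomial ℕ, ∀ c a b, esize (step c a b) ≤ esize b + Q.eval (esize c + esize a)) :
    Poly fun c => (l c).foldr (step c) (init c) := by
  have : (fun c => (l c).foldr (step c) (init c)) =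
      fun c => (l c).reverse.foldl (fun b a => step c a b) (init c) := by
    funext c
    simp
  rw [this]
  have hs' := hs.comp (f := fun p : γ × β × α => (p.1, p.2.2, p.2.1))
    (id.fst.pair (id.snd.snd.pair id.snd.fst))
  refine foldl (step := fun c b a => step c a b) hs' hl.reverse hi ?_
  obtain ⟨Q, hQ⟩ := hB
  obtain ⟨R, hR⟩ := hl.exists_esize_le
  obtain ⟨I, hI⟩ := hi.exists_esize_le
  refine ⟨I + R * Q.comp (.X + R), fun c l' hl' => ?_⟩
  -- The growth per step does not depend on the accumulator, so it adds up over the list instead of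
  -- compounding.
  have key : ∀ l' : List α, (∀ a ∈ l', esize a ≤ R.eval (esize c)) → ∀ b : β,
      esize (l'.foldl (fun b a => step c a b) b) ≤
        esize b + l'.length * Q.eval (esize c + R.eval (esize c)) := by
    intro l'
    induction l' with
    | nil => intro _ b; simp
    | cons a l' ih =>
      intro h b
      have h1 := ih (fun a ha => h a (by simp [ha])) (step c a b)
      have h2 := hQ c a b
      have h3 := polynomial_eval_mono Q (Nat.add_le_add_left (h a (by simp)) (esize c))
      simp only [List.foldl_cons, List.length_cons]
      have h4 : (l'.length + 1) * Q.eval (esize c + R.eval (esize c)) =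
        l'.length * Q.eval (esize c + R.eval (esize c)) + Q.eval (esize c + R.eval (esize c)) := by
        ring
      omega
  have hlen : l'.length ≤ R.eval (esize c) := by
    have := hl'.length_le
    have := length_lt_esize (l c)
    have := hR c
    simp at *
    omega
  have h1 := key l' (fun a ha => by
    have : a ∈ l c := by simpa using hl'.subset ha
    exact (esize_le_of_mem this).le.trans (hR c)) (init c)
  have h2 := hI c
  have h3 : l'.length * Q.eval (esize c + R.eval (esize c)) ≤
      R.eval (esize c) * Q.eval (esize c + R.eval (esize c)) := by gcongr
  simp only [Polynomial.eval_add, Polynomial.eval_mul, Polynomial.eval_X, Polynomial.eval_comp]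
  omega

lemma append {f g : α → List β} (hf : Poly f) (hg : Poly g) : Poly fun a => f a ++ g a := by
  have : (fun a => f a ++ g a) = fun a => (f a).foldr (fun x acc => x :: acc) (g a) := by
    funext a
    simp
  rw [this]
  exact foldr (step := fun _ x acc => x :: acc) (cons id.snd.fst id.snd.snd) hf hg
    ⟨.X + 1, fun c a b => by simp; omega⟩

lemma flatMap {l : γ → List α} {f : γ → α → List β} (hf : Poly fun p : γ × α => f p.1 p.2)
    (hl : Poly l) : Poly fun c => (l c).flatMap (f c) := by
  have : (fun c => (l c).flatMap (f c)) =
      fun c => (l c).foldr (fun x acc => f c x ++ acc) [] := by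
    funext c
    induction l c with
    | nil => rfl
    | cons a l ih => simp [ih]
  rw [this]
  refine foldr (step := fun c x acc => f c x ++ acc)
    (append (hf.comp (id.fst.pair id.snd.fst)) id.snd.snd) hl nil ?_
  obtain ⟨R, hR⟩ := hf.exists_esize_le
  refine ⟨R.comp (.X + 1), fun c a b => ?_⟩
  have := hR (c, a)
  have := esize_append (f c a) b
  simp at *
  omega

lemma map {l : γ → List α} {f : γ → α → β} (hf : Poly fun p : γ × α => f p.1 p.2)
    (hl : Poly l) : Poly fun c => (l c).map (f c) := by
  have : (fun c => (l c).map (f c)) = fun c => (l c).flatMap (fun a => [f c a]) := by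
    funext c
    exact List.map_eq_flatMap
  rw [this]
  exact flatMap (cons hf nil) hl

lemma filter {l : γ → List α} {f : γ → α → Bool} (hf : Poly fun p : γ × α => f p.1 p.2)
    (hl : Poly l) : Poly fun c => (l c).filter (f c) := by
  have : (fun c => (l c).filter (f c)) =
      fun c => (l c).flatMap (fun a => if f c a then [a] else []) := by
    funext c
    induction l c with
    | nil => rfl
    | cons a l ih => by_cases h : f c a <;> simp [h, ih]
  rw [this]
  exact flatMap (cond hf (cons id.snd nil) nil) hl

lemma length {l : γ → List α} (hl : Poly l) : Poly fun c => (l c).length := by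
  have : (fun c => (l c).length) = fun c => (l c).foldr (fun _ n => n + 1) 0 := by
    funext c
    induction l c with
    | nil => rfl
    | cons a l ih => rw [List.foldr_cons, ← ih, List.length_cons]
  rw [this]
  exact foldr (step := fun _ _ n => n + 1) (succ id.snd.snd) hl zero
    ⟨2, fun c a b => by rw [esize_nat, esize_nat, Polynomial.eval_ofNat]; omega⟩

lemma add {f g : α → ℕ} (hf : Poly f) (hg : Poly g) : Poly fun a => f a + g a := by
  have : (fun a => f a + g a) = fun a =>
      (List.replicate (f a) () ++ List.replicate (g a) ()).length := by
    funext a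
    simp
  rw [this]
  exact length (append hf.replicate hg.replicate)

lemma sub {f g : α → ℕ} (hf : Poly f) (hg : Poly g) : Poly fun a => f a - g a := by
  have : (fun a => f a - g a) = fun a => (List.replicate (g a) ()).foldr (fun _ n => n - 1) (f a) := by
    funext a
    induction g a with
    | zero => rfl
    | succ n ih => rw [List.replicate_succ, List.foldr_cons, ← ih]; omega
  rw [this]
  exact foldr (step := fun _ _ n => n - 1) (pred id.snd.snd) hg.replicate hf
    ⟨0, fun c a b => by rw [esize_nat, esize_nat]; omega⟩

lemma and {f g : α → Bool} (hf : Poly f) (hg : Poly g) : Poly fun a => f a && g a := by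
  have : (fun a => f a && g a) = fun a => if f a then g a else Bool.false := by
    funext a
    cases f a <;> rfl
  rw [this]
  exact cond hf hg false

lemma not {f : α → Bool} (hf : Poly f) : Poly fun a => !f a := by
  have : (fun a => !f a) = fun a => if f a then Bool.false else Bool.true := by
    funext a
    cases f a <;> rfl
  rw [this]
  exact cond hf false true

lemma le {f g : α → ℕ} (hf : Poly f) (hg : Poly g) : Poly fun a => decide (f a ≤ g a) := by
  have : (fun a => decide (f a ≤ g a)) = fun a => (List.replicate (f a - g a) ()).isEmpty := by
    funext a
    simp [Nat.sub_eq_zero_iff_le]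
  rw [this]
  exact isNil (sub hf hg).replicate

lemma lt {f g : α → ℕ} (hf : Poly f) (hg : Poly g) : Poly fun a => decide (f a < g a) :=
  le hf.succ hg

lemma eq {f g : α → ℕ} (hf : Poly f) (hg : Poly g) : Poly fun a => decide (f a = g a) := by
  have : (fun a => decide (f a = g a)) = fun a => decide (f a ≤ g a) && decide (g a ≤ f a) := by
    funext a
    simp [le_antisymm_iff]
  rw [this]
  exact and (le hf hg) (le hg hf)

lemma any {l : γ → List α} {f : γ → α → Bool} (hf : Poly fun p : γ × α => f p.1 p.2)
    (hl : Poly l) : Poly fun c => (l c).any (f c) := by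
  have : (fun c => (l c).any (f c)) = fun c => !((l c).filter (f c)).isEmpty := by
    funext c
    induction l c with
    | nil => rfl
    | cons a l ih => by_cases h : f c a <;> simp [h, ih]
  rw [this]
  exact not (isNil (filter hf hl))

lemma mem {f : α → ℕ} {l : α → List ℕ} (hf : Poly f) (hl : Poly l) :
    Poly fun a => decide (f a ∈ l a) := by
  have : (fun a => decide (f a ∈ l a)) = fun a => (l a).any fun x => decide (f a = x) := by
    funext a
    rw [Bool.eq_iff_iff]
    simp
  rw [this]
  exact any (eq (hf.comp id.fst) id.snd) hl

lemma dedup {l : α → List ℕ} (hl : Poly l) : Poly fun a => (l a).dedup := by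
  have : (fun a => (l a).dedup) =
      fun a => (l a).foldr (fun x acc => if decide (x ∈ acc) then acc else x :: acc) [] := by
    funext a
    induction l a with
    | nil => rfl
    | cons x l ih =>
      rw [List.foldr_cons, ← ih]
      by_cases h : x ∈ l <;> simp [h]
  rw [this]
  refine foldr (step := fun _ x acc => if decide (x ∈ acc) then acc else x :: acc)
    (cond (mem id.snd.fst id.snd.snd) id.snd.snd (cons id.snd.fst id.snd.snd)) hl nil
    ⟨.X + 1, fun c a b => ?_⟩
  split <;> simp
  omega

lemma idxOf {f : α → ℕ} {l : α → List ℕ} (hf : Poly f) (hl : Poly l) :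
    Poly fun a => (l a).idxOf (f a) := by
  have : (fun a => (l a).idxOf (f a)) =
      fun a => (l a).foldr (fun x n => if decide (x = f a) then 0 else n + 1) 0 := by
    funext a
    induction l a with
    | nil => rfl
    | cons x l ih =>
      rw [List.foldr_cons, ← ih, List.idxOf_cons]
      by_cases h : x = f a <;> simp [h]
      simp [beq_eq_false_iff_ne.2 h]
  rw [this]
  refine foldr (step := fun a x n => if decide (x = f a) then 0 else n + 1)
    (cond (eq id.snd.fst (hf.comp id.fst)) zero (succ id.snd.snd)) hl zero ⟨2, fun c a b => ?_⟩
  split <;> simp [esize_nat]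
  omega

lemma drop {f : α → ℕ} {l : α → List β} (hf : Poly f) (hl : Poly l) :
    Poly fun a => (l a).drop (f a) := by
  have : (fun a => (l a).drop (f a)) =
      fun a => (List.replicate (f a) ()).foldr (fun _ l => l.tail) (l a) := by
    funext a
    induction f a with
    | zero => rfl
    | succ n ih => rw [List.replicate_succ, List.foldr_cons, ← ih, List.tail_drop]
  rw [this]
  refine foldr (step := fun _ _ l => l.tail) (tail id.snd.snd) hf.replicate hl ⟨0, fun c a b => ?_⟩
  cases b <;> simp
  omega

lemma range {f : α → ℕ} (hf : Poly f) : Poly fun a => List.range (f a) := by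
  -- The length of the list built so far is the next entry.
  have key : ∀ n, (List.replicate n ()).foldl (fun (p : List ℕ) _ => p.length :: p) [] =
      (List.range n).reverse := by
    intro n
    induction n with
    | zero => rfl
    | succ n ih => rw [List.replicate_succ', List.foldl_append, ih, List.range_succ]; simp
  have : (fun a => List.range (f a)) = fun a =>
      ((List.replicate (f a) ()).foldl (fun (p : List ℕ) _ => p.length :: p) []).reverse := by
    funext a
    simp [key]
  rw [this]
  obtain ⟨R, hR⟩ := hf.exists_esize_le
  refine reverse (foldl (step := fun _ (p : List ℕ) _ => p.length :: p)
    (cons (length id.snd.fst) id.snd.fst) hf.replicate nil ⟨R * (R + 2) + 1, fun c l' hl' => ?_⟩)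
  obtain ⟨k, hk, rfl⟩ : ∃ k ≤ f c, l' = List.replicate k () :=
    ⟨l'.length, by simpa using hl'.length_le, List.eq_replicate_iff.2 ⟨rfl, fun _ _ => rfl⟩⟩
  have h1 := hR c
  rw [key, esize_reverse]
  refine (esize_list_le (B := R.eval (esize c) + 1) fun a ha => ?_).trans ?_
  · have := List.mem_range.1 ha
    rw [esize_nat] at h1 ⊢
    omega
  · rw [esize_nat] at h1
    simp only [List.length_range, Polynomial.eval_add, Polynomial.eval_mul, Polynomial.eval_ofNat,
      Polynomial.eval_one]
    exact Nat.add_le_add_right (Nat.mul_le_mul (by omega) (by omega)) 1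

end Poly

end

/-! ## Reconfiguration of multisets of arcs -/

/-- Colored arcs `(color, tail, head)`. -/
abbrev Arc (V : Type) := Color × V × V

/-- The reversed arc. -/
def rev {V : Type} (a : Arc V) : Arc V := (a.1, a.2.2, a.2.1)

/-- One of the arcs is reversed; the first component is the arc whose reversal is asked for. -/
def Flip {V : Type} (s s' : Arc V × Multiset (Arc V)) : Prop :=
  s' = (rev s.1, s.2) ∨ ∃ a N, s.2 = a ::ₘ N ∧ s' = (s.1, rev a ::ₘ N)

/-- All arcs of a state. -/
def arcs {V : Type} (s : Arc V × Multiset (Arc V)) : Multiset (Arc V) := s.1 ::ₘ s.2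

/-- A flip whose two states are compatible. -/
def Move {V : Type} (P : Multiset (Arc V) → Multiset (Arc V) → Prop)
    (s s' : Arc V × Multiset (Arc V)) : Prop :=
  P (arcs s) (arcs s') ∧ Flip s s'

/-- The distinguished arc can be changed by moves. -/
def Changeable {V : Type} (P : Multiset (Arc V) → Multiset (Arc V) → Prop)
    (s : Arc V × Multiset (Arc V)) : Prop :=
  ∃ s', Relation.ReflTransGen (Move P) s s' ∧ s'.1 ≠ s.1

/-- All ends of the arcs are in `U`. -/
def Within {V : Type} (U : Set V) (M : Multiset (Arc V)) : Prop :=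
  ∀ a ∈ M, a.2.1 ∈ U ∧ a.2.2 ∈ U

section

set_option linter.unusedSectionVars false

variable {V : Type} [DecidableEq V]

/-- The total weight of the arcs that enter `v`. -/
def inWeight (M : Multiset (Arc V)) (v : V) : ℕ :=
  (M.map fun a => if a.2.2 = v then a.1.weight else 0).sum

/-- The number of arcs that enter `v`. -/
def inDeg (M : Multiset (Arc V)) (v : V) : ℕ :=
  (M.filter fun a => a.2.2 = v).card

/-- The demand of each vertex of `U` is met. -/
def FeasOn (U : Finset V) (M : Multiset (Arc V)) : Prop :=
  ∀ v ∈ U, 2 ≤ inWeight M v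

/-- Both of the orientations are feasible. -/
def BothFeas (U : Finset V) (M M' : Multiset (Arc V)) : Prop :=
  FeasOn U M ∧ FeasOn U M'

lemma inWeight_add (M N : Multiset (Arc V)) (v : V) :
    inWeight (M + N) v = inWeight M v + inWeight N v := by
  simp [inWeight]

lemma inWeight_cons (a : Arc V) (M : Multiset (Arc V)) (v : V) :
    inWeight (a ::ₘ M) v = (if a.2.2 = v then a.1.weight else 0) + inWeight M v := by
  simp [inWeight]

lemma inDeg_cons (a : Arc V) (M : Multiset (Arc V)) (v : V) :
    inDeg (a ::ₘ M) v = (if a.2.2 = v then 1 else 0) + inDeg M v := by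
  by_cases h : a.2.2 = v <;> simp [inDeg, h, add_comm]

lemma inWeight_eq_of_blue {M : Multiset (Arc V)} (h : ∀ a ∈ M, a.1 = .blue) (v : V) :
    inWeight M v = 2 * inDeg M v := by
  induction M using Multiset.induction with
  | empty => rfl
  | cons a M ih =>
    rw [inWeight_cons, inDeg_cons, ih fun b hb => h b (by simp [hb]), h a (by simp)]
    split <;> simp [Color.weight, mul_add]

lemma exists_of_inDeg_pos {M : Multiset (Arc V)} {v : V} (h : 0 < inDeg M v) :
    ∃ a ∈ M, a.2.2 = v := by
  obtain ⟨a, ha⟩ := Multiset.card_pos_iff_exists_mem.1 h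
  exact ⟨a, Multiset.mem_of_mem_filter ha, (Multiset.mem_filter.1 ha).2⟩

lemma inDeg_pos {M : Multiset (Arc V)} {a : Arc V} (h : a ∈ M) : 0 < inDeg M a.2.2 :=
  Multiset.card_pos_iff_exists_mem.2 ⟨a, by simp [h]⟩

lemma inWeight_pos_of_mem {M : Multiset (Arc V)} {v : V} (h : 0 < inWeight M v) :
    ∃ a ∈ M, a.2.2 = v := by
  by_contra! hc
  have : inWeight M v = 0 := by
    refine Multiset.sum_eq_zero fun n hn => ?_
    obtain ⟨a, ha, rfl⟩ := Multiset.mem_map.1 hn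
    simp [hc a ha]
  omega

/-! ### Components -/

variable {L : Type} [DecidableEq L]

/-- The arcs whose heads have the label `l`. -/
def labelArcs (lab : V → L) (M : Multiset (Arc V)) (l : L) : ℕ :=
  (M.filter fun a => lab a.2.2 = l).card

/-- The component with the label `l` has fewer arcs than vertices. -/
def Deficient (U : Finset V) (lab : V → L) (M : Multiset (Arc V)) (l : L) : Prop :=
  labelArcs lab M l < (U.filter fun v => lab v = l).card

/-- The labels are the components of the blue graph with the vertex set `U`. -/
structure Components (U : Finset V) (lab : V → L) (M : Multiset (Arc V)) : Prop where
  blue : ∀ a ∈ M, a.1 = .blue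
  within : Within (U : Set V) M
  label : ∀ a ∈ M, lab a.2.1 = lab a.2.2
  connected : ∀ F : Set V, (∀ a ∈ M, a.2.1 ∈ F ↔ a.2.2 ∈ F) →
    ∀ u ∈ U, ∀ v ∈ U, lab u = lab v → u ∈ F → v ∈ F

lemma Components.rev {U : Finset V} {lab : V → L} {a : Arc V} {M : Multiset (Arc V)}
    (h : Components U lab (a ::ₘ M)) : Components U lab (rev a ::ₘ M) := by
  obtain ⟨h1, h2, h3, h4⟩ := h
  simp only [Within, Multiset.mem_cons, forall_eq_or_imp] at *
  refine ⟨?_, ?_, ?_, ?_⟩ <;> simp only [Within, Multiset.mem_cons, forall_eq_or_imp]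
  · exact h1
  · exact ⟨h2.1.symm, h2.2⟩
  · exact ⟨h3.1.symm, h3.2⟩
  · exact fun F hF => h4 F ⟨hF.1.symm, hF.2⟩

lemma labelArcs_rev {lab : V → L} {a : Arc V} (M : Multiset (Arc V))
    (h : lab a.2.1 = lab a.2.2) (l : L) : labelArcs lab (rev a ::ₘ M) l = labelArcs lab (a ::ₘ M) l := by
  simp only [labelArcs, ← Multiset.countP_eq_card_filter, Multiset.countP_cons]
  simp [NCL.rev, h]

lemma card_filter_mem_eq_sum (M : Multiset (Arc V)) (W : Finset V) :
    (M.filter fun a => a.2.2 ∈ W).card = ∑ v ∈ W, inDeg M v := by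
  induction M using Multiset.induction with
  | empty => simp [inDeg]
  | cons a M ih =>
    simp only [inDeg_cons, Finset.sum_add_distrib, ← ih]
    by_cases h : a.2.2 ∈ W <;> simp [h, add_comm]

lemma Components.labelArcs_eq {U : Finset V} {lab : V → L} {M : Multiset (Arc V)}
    (h : Components U lab M) (l : L) :
    labelArcs lab M l = ∑ v ∈ U.filter fun v => lab v = l, inDeg M v := by
  rw [← card_filter_mem_eq_sum, labelArcs]
  congr 1
  refine Multiset.filter_congr fun a ha => ?_
  have := (h.within a ha).2
  simp_all

/-- Pigeonhole: the in-degrees in a component sum up to its number of arcs, which is less than its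
number of vertices. -/
lemma Components.exists_inDeg_eq_zero {U : Finset V} {lab : V → L} {M : Multiset (Arc V)}
    (h : Components U lab M) {l : L} (hl : Deficient U lab M l) :
    ∃ v ∈ U, lab v = l ∧ inDeg M v = 0 := by
  by_contra! hc
  rw [Deficient, h.labelArcs_eq, Finset.card_eq_sum_ones] at hl
  refine hl.not_ge (Finset.sum_le_sum fun v hv => ?_)
  simp only [Finset.mem_filter] at hv
  exact Nat.one_le_iff_ne_zero.2 (hc v hv.1 hv.2)

/-! ### Covering all vertices but one of each deficient component -/

/-- There is a directed walk of `n` arcs. -/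
def Walk (M : Multiset (Arc V)) (v : V) : ℕ → V → Prop
  | 0, w => v = w
  | n + 1, w => ∃ a ∈ M, Walk M v n a.2.1 ∧ a.2.2 = w

/-- The vertices outside of `X` that no arc enters. -/
def uncovered (U : Finset V) (X : Set V) [DecidablePred (· ∈ X)] (M : Multiset (Arc V)) : Finset V :=
  U.filter fun v => v ∉ X ∧ inDeg M v = 0

/-- Flips of blue arcs in the presence of the arcs `N`. -/
def BlueMove (U : Finset V) (N M M' : Multiset (Arc V)) : Prop :=
  BothFeas U (N + M) (N + M') ∧ ∃ a K, M = a ::ₘ K ∧ M' = rev a ::ₘ K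

/-- The walk is reversed from its end `w`, which can spare an entering arc. Reversing the last arc
moves the surplus to its tail. If the tail was uncovered, it is now covered; otherwise it can in
turn spare an arc, and a shorter walk leads to it. Only vertices with a surplus ever lose an arc, so
feasibility persists. -/
lemma exists_uncovered_lt_of_walk {U : Finset V} {lab : V → L} {X : Set V} [DecidablePred (· ∈ X)]
    {N : Multiset (Arc V)} (hX : ∀ v ∈ X, 2 ≤ inWeight N v) {v : V} (hvX : v ∉ X)
    (n : ℕ) {M : Multiset (Arc V)} {w : V} (hM : Components U lab M) (hf : FeasOn U (N + M))
    (hv : inDeg M v = 0) (hw : Walk M v n w) (hs : 2 ≤ inDeg M w ∨ w ∈ X ∧ 1 ≤ inDeg M w) :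
    ∃ M', Relation.ReflTransGen (BlueMove U N) M M' ∧
      (uncovered U X M').card < (uncovered U X M).card := by
  induction n using Nat.strong_induction_on generalizing M w with
  | _ n ih =>
    -- The walk may be assumed to be a shortest one.
    by_cases hm : ∃ m < n, Walk M v m w
    · obtain ⟨m, hm, hmw⟩ := hm
      exact ih m hm hM hf hv hmw hs
    push Not at hm
    cases n with
    | zero =>
      obtain rfl : v = w := hw
      omega
    | succ n =>
      obtain ⟨a, ha, hu, rfl⟩ := hw
      obtain ⟨K, rfl⟩ := Multiset.exists_cons_of_mem ha
      have hne : a.2.1 ≠ a.2.2 := fun h => hm n (by omega) (h ▸ hu)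
      have hM' := hM.rev
      -- Prefixes of the walk survive the reversal of `a`: if one of them used `a`, it would reach
      -- `w` too early.
      have hwalk : ∀ m ≤ n, ∀ x, Walk (a ::ₘ K) v m x → Walk (rev a ::ₘ K) v m x := by
        intro m
        induction m with
        | zero => exact fun _ x hx => hx
        | succ m ihm =>
          rintro hmn x ⟨b, hb, hbx, rfl⟩
          refine ⟨b, ?_, ihm (by omega) _ hbx, rfl⟩
          rcases Multiset.mem_cons.1 hb with rfl | hb
          · exact absurd ⟨b, by simp, hbx, rfl⟩ (hm (m + 1) (by omega))
          · exact Multiset.mem_cons_of_mem hb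
      have hdeg : ∀ x, inDeg (rev a ::ₘ K) x + (if a.2.2 = x then 1 else 0) =
          inDeg (a ::ₘ K) x + (if a.2.1 = x then 1 else 0) := by
        intro x
        rw [inDeg_cons, inDeg_cons, show (rev a).2.2 = a.2.1 from rfl]
        omega
      have hf' : FeasOn U (N + rev a ::ₘ K) := by
        intro x hx
        by_cases hxX : x ∈ X
        · rw [inWeight_add]
          exact (hX x hxX).trans (Nat.le_add_right _ _)
        have h1 := hf x hx
        have h2 := hdeg x
        rw [inWeight_add, inWeight_eq_of_blue hM.blue] at h1
        rw [inWeight_add, inWeight_eq_of_blue hM'.blue]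
        split at h2
        · next h => subst h; simp only [hxX, false_and, or_false] at hs; omega
        · omega
      have hmove : BlueMove U N (a ::ₘ K) (rev a ::ₘ K) := ⟨⟨hf, hf'⟩, a, K, rfl, rfl⟩
      have hsub : uncovered U X (rev a ::ₘ K) ⊆ uncovered U X (a ::ₘ K) := by
        intro x hx
        simp only [uncovered, Finset.mem_filter] at hx ⊢
        obtain ⟨hxU, hxX, hx⟩ := hx
        refine ⟨hxU, hxX, ?_⟩
        have h2 := hdeg x
        split at h2
        · next h => subst h; simp only [hxX, false_and, or_false] at hs; omega
        · omega
      have hdu := hdeg a.2.1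
      rw [if_neg hne.symm, if_pos rfl] at hdu
      have huU := (hM.within a ha).1
      -- Either the tail becomes covered and the count drops, or the tail holds the surplus and the
      -- induction hypothesis applies to it.
      by_cases huc : a.2.1 ∈ uncovered U X (a ::ₘ K)
      · refine ⟨_, .single hmove, Finset.card_lt_card ⟨hsub, fun h => ?_⟩⟩
        have := h huc
        simp only [uncovered, Finset.mem_filter] at this
        omega
      · have hvu : a.2.1 ≠ v := by
          intro h
          refine huc ?_
          simp only [uncovered, Finset.mem_filter]
          exact ⟨huU, h ▸ hvX, h ▸ hv⟩
        obtain ⟨M', hr, hlt⟩ := ih n (by omega) hM' hf' (by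
            have h2 := hdeg v
            rw [if_neg hvu] at h2
            omega) (hwalk n le_rfl _ hu) (by
            simp only [uncovered, Finset.mem_filter, not_and] at huc
            by_cases h : a.2.1 ∈ X
            · exact Or.inr ⟨h, by omega⟩
            · have := huc huU h
              left
              omega)
        exact ⟨M', .head hmove hr, hlt.trans_le (Finset.card_le_card hsub)⟩

/-- Otherwise all vertices reachable from `v`, other than `v` itself, have in-degree exactly one.
The reachable set is then the whole component, which has one arc fewer than vertices and so contains
a vertex `t ∈ X`. As `t ≠ v`, it has in-degree one and is a surplus vertex after all. -/
lemma exists_walk_surplus {U : Finset V} {lab : V → L} {X : Set V} {M : Multiset (Arc V)}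
    (hM : Components U lab M) (hX : ∀ l, Deficient U lab M l → ∃ t ∈ U, lab t = l ∧ t ∈ X)
    {v : V} (hvU : v ∈ U) (hvX : v ∉ X) (hv : inDeg M v = 0) :
    ∃ n w, Walk M v n w ∧ (2 ≤ inDeg M w ∨ w ∈ X ∧ 1 ≤ inDeg M w) := by
  classical
  by_contra! hc
  let F : Set V := {w | ∃ n, Walk M v n w}
  have hin : ∀ w ∈ F, w ≠ v → ∃ a ∈ M, a.2.1 ∈ F ∧ a.2.2 = w := by
    rintro w ⟨n, hn⟩ hw
    cases n with
    | zero => exact absurd hn.symm hw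
    | succ n =>
      obtain ⟨a, ha, hu, rfl⟩ := hn
      exact ⟨a, ha, ⟨n, hu⟩, rfl⟩
  have hdeg : ∀ w ∈ F, w ≠ v → inDeg M w = 1 := by
    intro w hw hwv
    obtain ⟨a, ha, -, rfl⟩ := hin w hw hwv
    obtain ⟨n, hn⟩ := hw
    have := (hc n _ hn).1
    have := inDeg_pos ha
    omega
  -- Backwards: `v` is entered by no arc, and any other vertex of `F` is entered by a single arc,
  -- whose tail is in `F`.
  have hclosed : ∀ a ∈ M, a.2.1 ∈ F ↔ a.2.2 ∈ F := by
    intro a ha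
    constructor
    · rintro ⟨n, hn⟩
      exact ⟨n + 1, a, ha, hn, rfl⟩
    · intro h
      have hav : a.2.2 ≠ v := by
        intro h
        have := inDeg_pos ha
        rw [h] at this
        omega
      obtain ⟨b, hb, hbF, hba⟩ := hin _ h hav
      obtain ⟨c, hc⟩ := Multiset.card_eq_one.1 (hdeg _ h hav)
      have h1 : a ∈ ({c} : Multiset (Arc V)) := by rw [← hc]; simp [ha]
      have h2 : b ∈ ({c} : Multiset (Arc V)) := by rw [← hc]; simp [hb, hba]
      rw [Multiset.mem_singleton] at h1 h2
      rwa [h1, ← h2]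
  have hlab : ∀ n w, Walk M v n w → lab w = lab v ∧ w ∈ U := by
    intro n
    induction n with
    | zero => rintro w rfl; exact ⟨rfl, hvU⟩
    | succ n ih =>
      rintro w ⟨a, ha, hn, rfl⟩
      exact ⟨(hM.label a ha).symm.trans (ih _ hn).1, (hM.within a ha).2⟩
  have hF : ∀ w, w ∈ U.filter (fun u => lab u = lab v) ↔ w ∈ F := by
    intro w
    rw [Finset.mem_filter]
    constructor
    · rintro ⟨hw, hl⟩
      exact hM.connected F hclosed v hvU w hw hl.symm ⟨0, rfl⟩
    · rintro ⟨n, hn⟩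
      exact (hlab n w hn).symm
  obtain ⟨t, htU, htl, htX⟩ := hX (lab v) (by
    rw [Deficient, hM.labelArcs_eq, Finset.card_eq_sum_ones]
    refine Finset.sum_lt_sum (fun w hw => ?_) ⟨v, by simp [hvU], by omega⟩
    by_cases h : w = v
    · subst h; omega
    · exact (hdeg w ((hF w).1 hw) h).le)
  have htF : t ∈ F := (hF t).1 (by simp [htU, htl])
  have := hdeg t htF fun h => hvX (h ▸ htX)
  obtain ⟨n, hn⟩ := htF
  have := (hc n t hn).2 htX
  omega

lemma BlueMove.components {U : Finset V} {lab : V → L} {N M M' : Multiset (Arc V)}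
    (h : BlueMove U N M M') (hM : Components U lab M) : Components U lab M' := by
  obtain ⟨-, a, K, rfl, rfl⟩ := h
  exact hM.rev

lemma BlueMove.labelArcs {U : Finset V} {lab : V → L} {N M M' : Multiset (Arc V)}
    (h : BlueMove U N M M') (hM : Components U lab M) (l : L) :
    labelArcs lab M' l = labelArcs lab M l := by
  obtain ⟨-, a, K, rfl, rfl⟩ := h
  exact labelArcs_rev K (hM.label a (by simp)) l

lemma reflTransGen_blueMove {U : Finset V} {lab : V → L} {N M M' : Multiset (Arc V)}
    (h : Relation.ReflTransGen (BlueMove U N) M M') (hM : Components U lab M)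
    (hf : FeasOn U (N + M)) :
    Components U lab M' ∧ FeasOn U (N + M') ∧ ∀ l, labelArcs lab M' l = labelArcs lab M l := by
  induction h with
  | refl => exact ⟨hM, hf, fun _ => rfl⟩
  | tail _ h ih =>
    exact ⟨h.components ih.1, h.1.2, fun l => (h.labelArcs ih.1 l).trans (ih.2.2 l)⟩

lemma exists_uncovered_eq_empty {U : Finset V} {lab : V → L} {X : Set V} [DecidablePred (· ∈ X)]
    {N : Multiset (Arc V)} (hX : ∀ v ∈ X, 2 ≤ inWeight N v) {M : Multiset (Arc V)}
    (hM : Components U lab M) (hf : FeasOn U (N + M))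
    (hd : ∀ l, Deficient U lab M l → ∃ t ∈ U, lab t = l ∧ t ∈ X) :
    ∃ M', Relation.ReflTransGen (BlueMove U N) M M' ∧ uncovered U X M' = ∅ := by
  induction h : (uncovered U X M).card using Nat.strong_induction_on generalizing M with
  | _ k ih =>
    rcases (uncovered U X M).eq_empty_or_nonempty with he | ⟨v, hv⟩
    · exact ⟨M, .refl, he⟩
    simp only [uncovered, Finset.mem_filter] at hv
    obtain ⟨hvU, hvX, hv⟩ := hv
    obtain ⟨n, w, hw, hs⟩ := exists_walk_surplus hM hd hvU hvX hv
    obtain ⟨M₁, hr, hlt⟩ := exists_uncovered_lt_of_walk hX hvX n hM hf hv hw hs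
    obtain ⟨hM₁, hf₁, hl₁⟩ := reflTransGen_blueMove hr hM hf
    obtain ⟨M', hr', he⟩ := ih _ (h ▸ hlt) hM₁ hf₁ (by simpa only [Deficient, hl₁] using hd) rfl
    exact ⟨M', hr.trans hr', he⟩

/-! ### Forgetting the orientation of the blue components -/

/-- Each deficient component has a vertex whose demand is met by both of the orientations. -/
def Rooted (U : Finset V) (lab : V → L) (D : L → Prop) (N N' : Multiset (Arc V)) : Prop :=
  ∀ l, D l → ∃ t ∈ U, lab t = l ∧ 2 ≤ inWeight N t ∧ 2 ≤ inWeight N' t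

/-- `M` is common to both orientations, so a vertex that no arc of `M` enters must be served by `N`
as well as by `N'`. -/
lemma Components.rooted {U : Finset V} {lab : V → L} {D : L → Prop} {N N' M : Multiset (Arc V)}
    (hM : Components U lab M) (hD : ∀ l, D l → Deficient U lab M l) (hf : FeasOn U (N + M))
    (hf' : FeasOn U (N' + M)) : Rooted U lab D N N' := by
  intro l hl
  obtain ⟨t, ht, htl, h0⟩ := hM.exists_inDeg_eq_zero (hD l hl)
  have h1 := hf t ht
  have h2 := hf' t ht
  rw [inWeight_add, inWeight_eq_of_blue hM.blue, h0] at h1 h2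
  exact ⟨t, ht, htl, h1, h2⟩

lemma moves_of_blueMoves {U : Finset V} {a : Arc V} {R M M' : Multiset (Arc V)}
    (h : Relation.ReflTransGen (BlueMove U (a ::ₘ R)) M M') :
    Relation.ReflTransGen (Move (BothFeas U)) (a, R + M) (a, R + M') := by
  induction h with
  | refl => exact .refl
  | tail _ h ih =>
    refine ih.tail ?_
    obtain ⟨hf, b, K, rfl, rfl⟩ := h
    refine ⟨by simpa only [arcs, Multiset.cons_add] using hf, .inr ⟨b, R + K, ?_, ?_⟩⟩ <;>
      simp

/-- Before each special flip, the blue arcs are rearranged to enter every vertex that the special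
arcs do not serve on both sides of the flip. The numbers of arcs per label are carried along since
they keep the deficient labels unchanged. -/
lemma exists_moves_of_rooted {U : Finset V} {lab : V → L} {M : Multiset (Arc V)}
    (hM : Components U lab M) {s s' : Arc V × Multiset (Arc V)} (hf : FeasOn U (arcs s + M))
    (h : Relation.ReflTransGen (Move (Rooted U lab (Deficient U lab M))) s s') :
    ∃ M', Components U lab M' ∧ (∀ l, labelArcs lab M' l = labelArcs lab M l) ∧
      FeasOn U (arcs s' + M') ∧
      Relation.ReflTransGen (Move (BothFeas U)) (s.1, s.2 + M) (s'.1, s'.2 + M') := by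
  classical
  induction h with
  | refl => exact ⟨M, hM, fun _ => rfl, hf, .refl⟩
  | @tail s₁ s₂ _ h ih =>
    obtain ⟨M₁, hM₁, hl₁, hf₁, hr₁⟩ := ih
    let X : Set V := {t | 2 ≤ inWeight (arcs s₁) t ∧ 2 ≤ inWeight (arcs s₂) t}
    obtain ⟨M₂, hr₂, he⟩ := exists_uncovered_eq_empty (X := X) (N := arcs s₁) (fun v hv => hv.1) hM₁
      hf₁ fun l hl => h.1 l (by simpa only [Deficient, hl₁] using hl)
    obtain ⟨hM₂, hf₂, hl₂⟩ := reflTransGen_blueMove hr₂ hM₁ hf₁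
    -- After the flip, vertices of `X` are served by special arcs and all others by a blue arc of
    -- `M₂`.
    have hf₃ : FeasOn U (arcs s₂ + M₂) := by
      intro v hv
      rw [inWeight_add]
      by_cases hvX : v ∈ X
      · exact hvX.2.trans (Nat.le_add_right _ _)
      · have : v ∉ uncovered U X M₂ := by simp [he]
        simp only [uncovered, Finset.mem_filter, not_and] at this
        have := this hv hvX
        rw [inWeight_eq_of_blue hM₂.blue]
        omega
    refine ⟨M₂, hM₂, fun l => (hl₂ l).trans (hl₁ l), hf₃,
      (hr₁.trans (moves_of_blueMoves hr₂)).tail ⟨?_, ?_⟩⟩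
    · simp only [arcs, ← Multiset.cons_add]
      exact ⟨hf₂, hf₃⟩
    · obtain ⟨a, R⟩ := s₁
      rcases h.2 with rfl | ⟨b, N, hb, rfl⟩
      · exact .inl rfl
      · dsimp only at hb
        subst hb
        exact .inr ⟨b, N + M₂, by simp, by simp⟩

/-- Flips of blue component arcs are dropped from the sequence; the remaining flips leave the
component arcs fixed, so that `Components.rooted` applies. -/
lemma exists_rooted_of_moves {U : Finset V} {lab : V → L} {M : Multiset (Arc V)}
    (hM : Components U lab M) {s s' : Arc V × Multiset (Arc V)}
    (h : Relation.ReflTransGen (Move (BothFeas U)) (s.1, s.2 + M) s') :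
    ∃ M' R, s'.2 = R + M' ∧ Components U lab M' ∧ (∀ l, labelArcs lab M' l = labelArcs lab M l) ∧
      Relation.ReflTransGen (Move (Rooted U lab (Deficient U lab M))) s (s'.1, R) := by
  induction h with
  | refl => exact ⟨M, s.2, rfl, hM, fun _ => rfl, .refl⟩
  | @tail s₁ s₂ _ h ih =>
    obtain ⟨M₁, R, hR, hM₁, hl₁, hr⟩ := ih
    obtain ⟨⟨hf₁, hf₂⟩, h⟩ := h
    have hD : ∀ l, Deficient U lab M l → Deficient U lab M₁ l := fun l hl => by
      simpa only [Deficient, hl₁] using hl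
    obtain ⟨a, R₁⟩ := s₁
    dsimp only at hR hr
    subst hR
    rcases h with rfl | ⟨b, K, hb, rfl⟩
    · refine ⟨M₁, R, rfl, hM₁, hl₁, hr.tail ⟨hM₁.rooted hD ?_ ?_, .inl rfl⟩⟩
      · simpa only [arcs, Multiset.cons_add] using hf₁
      · simpa only [arcs, Multiset.cons_add] using hf₂
    · dsimp only at hb
      have hmem : b ∈ R + M₁ := hb ▸ Multiset.mem_cons_self b K
      -- Equal arcs may occur in both parts. Either attribution is fine, because the splitting of
      -- the state is only asserted to exist.
      rcases Multiset.mem_add.1 hmem with hbR | hbM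
      · obtain ⟨R', rfl⟩ := Multiset.exists_cons_of_mem hbR
        have hK : K = R' + M₁ := by
          rw [Multiset.cons_add] at hb
          exact ((Multiset.cons_inj_right b).1 hb).symm
        subst hK
        refine ⟨M₁, rev b ::ₘ R', by simp, hM₁, hl₁,
          hr.tail ⟨hM₁.rooted hD ?_ ?_, .inr ⟨b, R', rfl, rfl⟩⟩⟩
        · simpa only [arcs, Multiset.cons_add] using hf₁
        · simpa only [arcs, Multiset.cons_add] using hf₂
      · obtain ⟨M', rfl⟩ := Multiset.exists_cons_of_mem hbM
        have hK : K = R + M' := by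
          rw [Multiset.add_cons] at hb
          exact ((Multiset.cons_inj_right b).1 hb).symm
        subst hK
        exact ⟨rev b ::ₘ M', R, by simp, hM₁.rev,
          fun l => (labelArcs_rev M' (hM₁.label b (by simp)) l).trans (hl₁ l), hr⟩

/-- Only the deficient components matter, not their orientations. -/
lemma changeable_iff_rooted {U : Finset V} {lab : V → L} {M : Multiset (Arc V)}
    (hM : Components U lab M) {s : Arc V × Multiset (Arc V)} (hf : FeasOn U (arcs s + M)) :
    Changeable (BothFeas U) (s.1, s.2 + M) ↔
      Changeable (Rooted U lab (Deficient U lab M)) s := by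
  constructor
  · rintro ⟨s', hr, hne⟩
    obtain ⟨M', R, -, -, -, hr'⟩ := exists_rooted_of_moves hM hr
    exact ⟨_, hr', hne⟩
  · rintro ⟨s', hr, hne⟩
    obtain ⟨M', -, -, -, hr'⟩ := exists_moves_of_rooted hM hf hr
    exact ⟨_, hr', hne⟩

lemma Flip.within {T : Set V} {s s' : Arc V × Multiset (Arc V)} (h : Flip s s')
    (hs : Within T (arcs s)) : Within T (arcs s') := by
  rcases h with rfl | ⟨a, N, ha, rfl⟩
  · simp only [Within, arcs, Multiset.mem_cons, forall_eq_or_imp] at hs ⊢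
    exact ⟨hs.1.symm, hs.2⟩
  · simp only [Within, arcs, ha, Multiset.mem_cons, forall_eq_or_imp] at hs ⊢
    exact ⟨hs.1, hs.2.1.symm, hs.2.2⟩

/-- The set meets all components with labels in `D`. -/
def Hits (U : Finset V) (lab : V → L) (D : L → Prop) (X : Set V) : Prop :=
  ∀ l, D l → ∃ t ∈ U, lab t = l ∧ t ∈ X

variable {L' : Type} [DecidableEq L']

/-- A move depends on the components only through the set of vertices served on both sides. This set
consists of heads of special arcs, and flips keep their ends inside `T`. -/
lemma changeable_rooted_of_hits {U : Finset V} {lab : V → L} {D : L → Prop} {U' : Finset V}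
    {lab' : V → L'} {D' : L' → Prop} {T : Set V} {s : Arc V × Multiset (Arc V)}
    (hT : Within T (arcs s)) (h : ∀ X ⊆ T, Hits U lab D X → Hits U' lab' D' X)
    (hs : Changeable (Rooted U lab D) s) : Changeable (Rooted U' lab' D') s := by
  obtain ⟨s', hr, hne⟩ := hs
  suffices H : Relation.ReflTransGen (Move (Rooted U' lab' D')) s s' ∧ Within T (arcs s') from
    ⟨s', H.1, hne⟩
  clear hne
  induction hr with
  | refl => exact ⟨.refl, hT⟩
  | @tail s₁ s₂ _ hm ih =>
    refine ⟨ih.1.tail ⟨?_, hm.2⟩, hm.2.within ih.2⟩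
    refine h {t | 2 ≤ inWeight (arcs s₁) t ∧ 2 ≤ inWeight (arcs s₂) t} (fun t ht => ?_) hm.1
    obtain ⟨a, ha, rfl⟩ := inWeight_pos_of_mem (zero_lt_two.trans_le ht.1)
    exact (ih.2 a ha).2

/-- The blue components can be replaced by others with the same roots. -/
theorem changeable_congr {U : Finset V} {lab : V → L} {M : Multiset (Arc V)} {U' : Finset V}
    {lab' : V → L'} {M' : Multiset (Arc V)} (hM : Components U lab M) (hM' : Components U' lab' M')
    {s : Arc V × Multiset (Arc V)} (hf : FeasOn U (arcs s + M)) (hf' : FeasOn U' (arcs s + M'))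
    {T : Set V} (hT : Within T (arcs s))
    (h : ∀ X ⊆ T, Hits U lab (Deficient U lab M) X ↔ Hits U' lab' (Deficient U' lab' M') X) :
    Changeable (BothFeas U) (s.1, s.2 + M) ↔ Changeable (BothFeas U') (s.1, s.2 + M') := by
  rw [changeable_iff_rooted hM hf, changeable_iff_rooted hM' hf']
  exact ⟨changeable_rooted_of_hits hT fun X hX => (h X hX).1,
    changeable_rooted_of_hits hT fun X hX => (h X hX).2⟩

/-! ### Renaming the vertices -/

variable {W : Type} [DecidableEq W]

/-- The arc with renamed ends. -/
def mapArc (f : V → W) (a : Arc V) : Arc W := (a.1, f a.2.1, f a.2.2)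

/-- The state with renamed vertices. -/
def mapState (f : V → W) (s : Arc V × Multiset (Arc V)) : Arc W × Multiset (Arc W) :=
  (mapArc f s.1, s.2.map (mapArc f))

lemma arcs_mapState (f : V → W) (s : Arc V × Multiset (Arc V)) :
    arcs (mapState f s) = (arcs s).map (mapArc f) := by
  simp [arcs, mapState]

lemma inWeight_map {U : Set V} {f : V → W} (hf : Set.InjOn f U) {M : Multiset (Arc V)}
    (hM : Within U M) {v : V} (hv : v ∈ U) : inWeight (M.map (mapArc f)) (f v) = inWeight M v := by
  rw [inWeight, inWeight, Multiset.map_map]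
  congr 1
  refine Multiset.map_congr rfl fun a ha => ?_
  simp only [Function.comp, mapArc, hf.eq_iff (hM a ha).2 hv]

lemma feasOn_map {U : Finset V} {f : V → W} (hf : Set.InjOn f U) {M : Multiset (Arc V)}
    (hM : Within (U : Set V) M) : FeasOn (U.image f) (M.map (mapArc f)) ↔ FeasOn U M := by
  simp only [FeasOn, Finset.mem_image, forall_exists_index, and_imp, forall_apply_eq_imp_iff₂]
  exact forall₂_congr fun v hv => by rw [inWeight_map hf hM hv]

lemma Flip.map (f : V → W) {s s' : Arc V × Multiset (Arc V)} (h : Flip s s') :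
    Flip (mapState f s) (mapState f s') := by
  rcases h with rfl | ⟨a, N, ha, rfl⟩
  · exact .inl rfl
  · exact .inr ⟨mapArc f a, N.map (mapArc f), by simp [mapState, ha], by simp [mapState, mapArc, NCL.rev]⟩

lemma changeable_map_of {U : Finset V} {f : V → W} (hf : Set.InjOn f U)
    {s : Arc V × Multiset (Arc V)} (hs : Within (U : Set V) (arcs s))
    (h : Changeable (BothFeas U) s) : Changeable (BothFeas (U.image f)) (mapState f s) := by
  obtain ⟨s', hr, hne⟩ := h
  have H : Relation.ReflTransGen (Move (BothFeas (U.image f))) (mapState f s) (mapState f s') ∧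
      Within (U : Set V) (arcs s') := by
    clear hne
    induction hr with
    | refl => exact ⟨.refl, hs⟩
    | @tail s₁ s₂ _ hm ih =>
      have hw := hm.2.within ih.2
      refine ⟨ih.1.tail ⟨?_, hm.2.map f⟩, hw⟩
      rw [arcs_mapState, arcs_mapState]
      exact ⟨(feasOn_map hf ih.2).2 hm.1.1, (feasOn_map hf hw).2 hm.1.2⟩
  -- Injectivity on `U` ensures that a changed arc stays changed after renaming.
  refine ⟨_, H.1, fun he => hne ?_⟩
  have h1 := H.2 s'.1 (by simp [arcs])
  have h2 := hs s.1 (by simp [arcs])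
  simp only [mapState, mapArc, Prod.mk.injEq] at he
  exact Prod.ext he.1 (Prod.ext (hf h1.1 h2.1 he.2.1) (hf h1.2 h2.2 he.2.2))

lemma changeable_map {U : Finset V} {f : V → W} (hf : Set.InjOn f U)
    {s : Arc V × Multiset (Arc V)} (hs : Within (U : Set V) (arcs s)) :
    Changeable (BothFeas (U.image f)) (mapState f s) ↔ Changeable (BothFeas U) s := by
  refine ⟨fun h => ?_, changeable_map_of hf hs⟩
  have : Nonempty V := ⟨s.1.2.1⟩
  -- The converse is the forward direction applied to an inverse of the renaming.
  let g := Function.invFunOn f (U : Set V)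
  have hg : ∀ v ∈ U, g (f v) = v := fun v hv => hf.leftInvOn_invFunOn hv
  have hgi : Set.InjOn g (U.image f : Finset W) := by
    intro x hx y hy hxy
    simp only [Finset.coe_image, Set.mem_image, Finset.mem_coe] at hx hy
    obtain ⟨v, hv, rfl⟩ := hx
    obtain ⟨w, hw, rfl⟩ := hy
    rw [hg v hv, hg w hw] at hxy
    rw [hxy]
  have hU : (U.image f).image g = U := by
    rw [Finset.image_image]
    ext v
    simp only [Finset.mem_image, Function.comp]
    constructor
    · rintro ⟨w, hw, rfl⟩
      rwa [hg w hw]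
    · exact fun hv => ⟨v, hv, hg v hv⟩
  have hga : ∀ a ∈ arcs s, mapArc g (mapArc f a) = a := by
    intro a ha
    simp [mapArc, hg _ (hs a ha).1, hg _ (hs a ha).2]
  have hgs : mapState g (mapState f s) = s := by
    refine Prod.ext (hga _ (by simp [arcs])) ?_
    simp only [mapState, Multiset.map_map]
    conv_rhs => rw [← Multiset.map_id s.2]
    exact Multiset.map_congr rfl fun a ha => hga a (by simp [arcs, ha])
  have := changeable_map_of hgi (s := mapState f s) (by
    intro a ha
    rw [arcs_mapState] at ha
    obtain ⟨b, hb, rfl⟩ := Multiset.mem_map.1 ha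
    simp only [Finset.coe_image]
    exact ⟨⟨_, (hs b hb).1, rfl⟩, ⟨_, (hs b hb).2, rfl⟩⟩) h
  rwa [hU, hgs] at this

end

/-! ## Instances as lists of arcs -/

section

set_option linter.unusedSectionVars false

variable {V E : Type} [Fintype V] [Fintype E] [DecidableEq V] [DecidableEq E]

/-- The state that belongs to an orientation. -/
def stateOf {G : ConstraintGraph V E} (A : Orientation G) (e : E) : Arc V × Multiset (Arc V) :=
  ((G.color e, A.arc e), (Finset.univ.erase e).val.map fun i => (G.color i, A.arc i))

lemma arcs_stateOf {G : ConstraintGraph V E} (A : Orientation G) (e : E) :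
    arcs (stateOf A e) = Finset.univ.val.map fun i => (G.color i, A.arc i) := by
  rw [arcs, stateOf, ← Finset.insert_erase (Finset.mem_univ e),
    Finset.insert_val_of_notMem (Finset.notMem_erase e _), Multiset.map_cons, Finset.insert_erase
    (Finset.mem_univ e)]

lemma inWeight_eq_indegree {G : ConstraintGraph V E} (A : Orientation G) (e : E) (v : V) :
    inWeight (arcs (stateOf A e)) v =
      Color.red.weight * A.indegree .red v + Color.blue.weight * A.indegree .blue v := by
  rw [arcs_stateOf, inWeight, Multiset.map_map]
  simp only [Orientation.indegree, Finset.card_filter, Finset.mul_sum, ← Finset.sum_add_distrib]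
  refine Finset.sum_congr rfl fun i _ => ?_
  by_cases h : (A.arc i).2 = v <;> cases hc : G.color i <;> simp [h, hc]

lemma feasible_iff_feasOn {G : ConstraintGraph V E} (A : Orientation G) (e : E) :
    A.Feasible ↔ FeasOn Finset.univ (arcs (stateOf A e)) := by
  simp [FeasOn, Orientation.Feasible, inWeight_eq_indegree]

/-- The orientation after the reversal of an edge. -/
def Orientation.reverse {G : ConstraintGraph V E} (A : Orientation G) (i : E) : Orientation G where
  arc := Function.update A.arc i (A.arc i).swap
  arc_ends e := by
    by_cases h : e = i
    · subst h
      simp only [Function.update_self, Prod.fst_swap, Prod.snd_swap]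
      rw [Sym2.eq_swap, A.arc_ends]
    · rw [Function.update_of_ne h, A.arc_ends]

lemma Orientation.adj_reverse {G : ConstraintGraph V E} (A : Orientation G) (i : E) :
    A.Adj (A.reverse i) :=
  .inr ⟨i, by simp [reverse], fun e' h => by simp [reverse, h]⟩

lemma Orientation.Adj.eq_or_eq_reverse {G : ConstraintGraph V E} {A B : Orientation G}
    (h : A.Adj B) : B = A ∨ ∃ i, B = A.reverse i := by
  rcases h with rfl | ⟨i, hi, h⟩
  · exact .inl rfl
  · refine .inr ⟨i, ?_⟩
    ext1
    funext e
    by_cases he : e = i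
    · subst he; simp [reverse, hi]
    · simp [reverse, h e he, he]

lemma stateOf_reverse_self {G : ConstraintGraph V E} (A : Orientation G) (e : E) :
    stateOf (A.reverse e) e = (rev (stateOf A e).1, (stateOf A e).2) := by
  refine Prod.ext ?_ ?_
  · simp [stateOf, Orientation.reverse, rev, Prod.swap]
  · refine Multiset.map_congr rfl fun i hi => ?_
    have : i ≠ e := Finset.ne_of_mem_erase (Finset.mem_def.2 hi)
    simp [Orientation.reverse, this]

lemma stateOf_snd_eq_cons {G : ConstraintGraph V E} (A : Orientation G) {e i : E} (h : i ≠ e) :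
    (stateOf A e).2 = (G.color i, A.arc i) ::ₘ
      ((Finset.univ.erase e).erase i).val.map fun i => (G.color i, A.arc i) := by
  have hi : i ∈ Finset.univ.erase e := Finset.mem_erase.2 ⟨h, Finset.mem_univ i⟩
  rw [stateOf]
  dsimp only
  conv_lhs => rw [← Finset.insert_erase hi,
    Finset.insert_val_of_notMem (Finset.notMem_erase i _), Multiset.map_cons]

lemma stateOf_reverse {G : ConstraintGraph V E} (A : Orientation G) {e i : E} (h : i ≠ e) :
    stateOf (A.reverse i) e = ((stateOf A e).1, rev (G.color i, A.arc i) ::ₘ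
      ((Finset.univ.erase e).erase i).val.map fun i => (G.color i, A.arc i)) := by
  refine Prod.ext ?_ ?_
  · simp [stateOf, Orientation.reverse, h.symm]
  · rw [stateOf_snd_eq_cons _ h]
    dsimp only
    congr 1
    · simp [Orientation.reverse, rev, Prod.swap]
    · refine Multiset.map_congr rfl fun j hj => ?_
      have : j ≠ i := Finset.ne_of_mem_erase (Finset.mem_def.2 hj)
      simp [Orientation.reverse, this]

lemma flip_stateOf_reverse {G : ConstraintGraph V E} (A : Orientation G) (e i : E) :
    Flip (stateOf A e) (stateOf (A.reverse i) e) := by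
  by_cases h : i = e
  · subst h
    exact .inl (stateOf_reverse_self A i)
  · exact .inr ⟨_, _, stateOf_snd_eq_cons A h, stateOf_reverse A h⟩

lemma Flip.exists_reverse {G : ConstraintGraph V E} {A : Orientation G} {e : E}
    {s : Arc V × Multiset (Arc V)} (h : Flip (stateOf A e) s) :
    ∃ i, s = stateOf (A.reverse i) e := by
  rcases h with rfl | ⟨a, N, ha, rfl⟩
  · exact ⟨e, (stateOf_reverse_self A e).symm⟩
  · have hmem : a ∈ (stateOf A e).2 := ha ▸ Multiset.mem_cons_self a N
    obtain ⟨i, hi, rfl⟩ := Multiset.mem_map.1 hmem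
    have hie : i ≠ e := Finset.ne_of_mem_erase (Finset.mem_def.2 hi)
    refine ⟨i, ?_⟩
    rw [stateOf_reverse A hie]
    rw [stateOf_snd_eq_cons A hie, Multiset.cons_inj_right] at ha
    rw [ha]

/-- Passing to multisets forgets only which edge carries which arc. The edge `e` is kept apart, and
each flip of a state lifts to the reversal of an edge, so nothing relevant is lost. Trivial steps
between equal orientations are skipped. -/
lemma exists_reachable_iff_changeable {G : ConstraintGraph V E} (A : Orientation G)
    (hA : A.Feasible) (e : E) :
    (∃ B : Orientation G, B.Feasible ∧ A.Reachable B ∧ B.arc e ≠ A.arc e) ↔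
      Changeable (BothFeas Finset.univ) (stateOf A e) := by
  constructor
  · rintro ⟨B, -, hr, hne⟩
    refine ⟨stateOf B e, ?_, fun h => hne (Prod.ext_iff.1 h).2⟩
    clear hne
    induction hr with
    | refl => exact .refl
    | @tail C D _ h ih =>
      obtain ⟨hC, hD, h⟩ := h
      rcases h.eq_or_eq_reverse with rfl | ⟨i, rfl⟩
      · exact ih
      · exact ih.tail ⟨⟨(feasible_iff_feasOn _ e).1 hC, (feasible_iff_feasOn _ e).1 hD⟩,
          flip_stateOf_reverse C e i⟩
  · rintro ⟨s, hr, hne⟩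
    suffices H : ∃ B : Orientation G, B.Feasible ∧ A.Reachable B ∧ stateOf B e = s by
      obtain ⟨B, hB, hAB, rfl⟩ := H
      exact ⟨B, hB, hAB, fun h => hne (by simp [stateOf, h])⟩
    clear hne
    induction hr with
    | refl => exact ⟨A, hA, .refl, rfl⟩
    | @tail s₁ s₂ _ h ih =>
      obtain ⟨B, hB, hAB, rfl⟩ := ih
      obtain ⟨hf, h⟩ := h
      obtain ⟨i, rfl⟩ := h.exists_reverse
      have hf' := (feasible_iff_feasOn _ e).2 hf.2
      exact ⟨_, hf', hAB.tail ⟨hB, hf', B.adj_reverse i⟩, rfl⟩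

/-- The number of ends of arcs of color `c` at `v`. -/
def multiDegree (M : Multiset (Arc V)) (c : Color) (v : V) : ℕ :=
  (M.filter fun a => a.1 = c ∧ a.2.1 = v).card + (M.filter fun a => a.1 = c ∧ a.2.2 = v).card

end

namespace C2EInstance

/-- The list of the colored arcs of the instance. -/
def arcList (I : C2EInstance) : List (Arc ℕ) :=
  List.ofFn fun i : Fin I.m => (I.G.color i, ((I.Aini.arc i).1 : ℕ), ((I.Aini.arc i).2 : ℕ))

/-- The initial state. -/
def state (I : C2EInstance) : Arc ℕ × Multiset (Arc ℕ) :=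
  mapState Fin.val (stateOf I.Aini I.e)

lemma arcs_state (I : C2EInstance) : arcs I.state = I.arcList := by
  rw [state, arcs_mapState, arcs_stateOf, Multiset.map_map, arcList, Fin.univ_val_map]
  rfl

lemma length_arcList (I : C2EInstance) : I.arcList.length = I.m := by simp [arcList]

lemma e_lt_length (I : C2EInstance) : (I.e : ℕ) < I.arcList.length := by
  rw [length_arcList]
  exact I.e.2

lemma state_fst (I : C2EInstance) : I.state.1 = I.arcList[(I.e : ℕ)]'I.e_lt_length := by
  simp [state, mapState, mapArc, stateOf, arcList]

lemma state_snd (I : C2EInstance) : I.state.2 = (I.arcList.eraseIdx I.e : List (Arc ℕ)) := by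
  have h := I.arcs_state
  have h2 := Multiset.coe_eq_coe.2 (List.getElem_cons_eraseIdx_perm I.e_lt_length)
  rw [arcs, I.state_fst, ← h2, ← Multiset.cons_coe, Multiset.cons_inj_right] at h
  exact h

lemma image_univ (n : ℕ) : (Finset.univ : Finset (Fin n)).image Fin.val = Finset.range n := by
  ext i
  simp only [Finset.mem_image, Finset.mem_univ, true_and, Finset.mem_range]
  exact ⟨fun ⟨j, h⟩ => h ▸ j.2, fun h => ⟨⟨i, h⟩, rfl⟩⟩

lemma within (I : C2EInstance) : ∀ a ∈ I.arcList, a.2.1 < I.n ∧ a.2.2 < I.n := by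
  intro a ha
  obtain ⟨i, rfl⟩ := (List.mem_ofFn' _ _).1 ha
  exact ⟨(I.Aini.arc i).1.2, (I.Aini.arc i).2.2⟩

lemma feasOn (I : C2EInstance) : FeasOn (Finset.range I.n) (I.arcList : Multiset (Arc ℕ)) := by
  rw [← I.arcs_state, state, arcs_mapState, ← image_univ,
    feasOn_map Fin.val_injective.injOn fun a _ => by simp]
  exact (feasible_iff_feasOn _ _).1 I.feasible

lemma yes_iff (I : C2EInstance) : I.Yes ↔ Changeable (BothFeas (Finset.range I.n)) I.state := by
  rw [← image_univ, state, changeable_map Fin.val_injective.injOn fun a _ => by simp]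
  exact exists_reachable_iff_changeable I.Aini I.feasible I.e

/-- A loop is counted twice on both sides: on the right once for its tail and once for its head. -/
lemma degree_eq (I : C2EInstance) (c : Color) (v : Fin I.n) :
    I.G.degree c v = multiDegree (I.arcList : Multiset (Arc ℕ)) c v := by
  have h : ∀ i, I.G.ends i = s((I.Aini.arc i).1, (I.Aini.arc i).2) := fun i => (I.Aini.arc_ends i).symm
  rw [← I.arcs_state, state, arcs_mapState, arcs_stateOf, multiDegree, Multiset.map_map,
    ConstraintGraph.degree, Multiset.filter_map, Multiset.filter_map, Multiset.card_map,
    Multiset.card_map]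
  simp only [Function.comp, mapArc, h, Sym2.mem_iff, Sym2.eq_iff, Fin.val_inj]
  change _ = (Finset.univ.filter _).card + (Finset.univ.filter _).card
  simp only [Finset.card_filter, ← Finset.sum_add_distrib]
  refine Finset.sum_congr rfl fun i _ => ?_
  have h1 : v = (I.Aini.arc i).1 ↔ (I.Aini.arc i).1 = v := eq_comm
  have h2 : v = (I.Aini.arc i).2 ↔ (I.Aini.arc i).2 = v := eq_comm
  simp only [h1, h2]
  by_cases hc : I.G.color i = c <;> by_cases h1 : (I.Aini.arc i).1 = v <;>
    by_cases h2 : (I.Aini.arc i).2 = v <;> simp [mapArc, hc, h1, h2, Fin.val_inj]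

lemma numRed_eq (I : C2EInstance) :
    I.G.numRed = (I.arcList.filter fun a => decide (a.1 = .red)).length := by
  have : ((I.arcList : Multiset (Arc ℕ)).filter fun a => a.1 = .red).card = I.G.numRed := by
    rw [← I.arcs_state, state, arcs_mapState, arcs_stateOf, Multiset.map_map, Multiset.filter_map,
      Multiset.card_map]
    rfl
  rw [← this]
  simp

lemma enc_eq (I : C2EInstance) : I.enc = Encoded.enc (I.n, (I.e : ℕ), I.arcList) := by
  simp only [enc, Encoded.enc, arcList, List.map_ofFn]
  rfl

/-- The instance that is given by a list of arcs. -/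
lemma exists_arcList_eq {n e : ℕ} {l : List (Arc ℕ)} (he : e < l.length)
    (hl : ∀ a ∈ l, a.2.1 < n ∧ a.2.2 < n) (hf : FeasOn (Finset.range n) (l : Multiset (Arc ℕ))) :
    ∃ I : C2EInstance, I.n = n ∧ (I.e : ℕ) = e ∧ I.arcList = l := by
  have hl' : ∀ i : Fin l.length, l[i].2.1 < n ∧ l[i].2.2 < n := fun i => hl _ (List.getElem_mem _)
  let G : ConstraintGraph (Fin n) (Fin l.length) :=
    ⟨fun i => s(⟨l[i].2.1, (hl' i).1⟩, ⟨l[i].2.2, (hl' i).2⟩), fun i => l[i].1⟩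
  let A : Orientation G :=
    ⟨fun i => (⟨l[i].2.1, (hl' i).1⟩, ⟨l[i].2.2, (hl' i).2⟩), fun _ => rfl⟩
  have harcs : (arcs (stateOf A ⟨e, he⟩)).map (mapArc Fin.val) = (l : Multiset (Arc ℕ)) := by
    rw [arcs_stateOf, Multiset.map_map, Fin.univ_val_map]
    congr 1
    exact List.ofFn_getElem
  refine ⟨⟨n, l.length, G, A, ?_, ⟨e, he⟩⟩, rfl, rfl, ?_⟩
  · rw [feasible_iff_feasOn A ⟨e, he⟩, ← feasOn_map Fin.val_injective.injOn fun a _ => by simp,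
      harcs, image_univ]
    exact hf
  · exact List.ofFn_getElem

end C2EInstance

/-! ## The kernelization algorithms -/

/-- The ends of the arcs. -/
def endsOf (l : List (Arc ℕ)) : List ℕ := l.flatMap fun a => [a.2.1, a.2.2]

/-- The arc `e`, followed by the other red arcs. -/
def special (e : ℕ) (l : List (Arc ℕ)) : List (Arc ℕ) :=
  (l.drop e).take 1 ++ (l.eraseIdx e).filter fun a => !decide (a.1 = .blue)

/-- The blue arcs other than `e`. -/
def ordinary (e : ℕ) (l : List (Arc ℕ)) : List (Arc ℕ) :=
  (l.eraseIdx e).filter fun a => decide (a.1 = .blue)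

/-- The label of the vertex `v`. -/
def labelOf (lab : List ℕ) (v : ℕ) : ℕ := (lab.drop v).headD 0

/-- The labels after the addition of an arc. -/
def mergeLabels (lab : List ℕ) (a : Arc ℕ) : List ℕ :=
  lab.map fun l => if decide (l = labelOf lab a.2.1) then labelOf lab a.2.2 else l

/-- The labels of the components of the graph with vertices `0, …, n - 1`. -/
def labels (n : ℕ) (O : List (Arc ℕ)) : List ℕ := O.foldl mergeLabels (List.range n)

/-- Whether the component with the label `l` has fewer arcs than vertices. -/
def isDeficient (lab : List ℕ) (O : List (Arc ℕ)) (l : ℕ) : Bool :=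
  decide ((O.filter fun a => decide (labelOf lab a.2.2 = l)).length <
    (lab.filter fun k => decide (k = l)).length)

/-- The arc between a terminal and the center of its component, and a loop at the center unless the
component is deficient. -/
def starArcs (n : ℕ) (O : List (Arc ℕ)) (lab : List ℕ) (t : ℕ) : List (Arc ℕ) :=
  (if O.any fun a => decide (a.2.2 = t) then (.blue, n + labelOf lab t, t)
    else (.blue, t, n + labelOf lab t)) ::
  if isDeficient lab O (labelOf lab t) then []
    else [(.blue, n + labelOf lab t, n + labelOf lab t)]

/-- Replaces each blue component by a star. -/
def starReplace (n : ℕ) (S O : List (Arc ℕ)) : List (Arc ℕ) :=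
  (endsOf S).dedup.flatMap (starArcs n O (labels n O))

/-- Arcs at a terminal of a component that is not deficient. -/
def pendantArcs (n : ℕ) (O : List (Arc ℕ)) (lab : List ℕ) (t : ℕ) : List (Arc ℕ) :=
  if isDeficient lab O (labelOf lab t) then []
  else if decide (((endsOf O).filter fun v => decide (v = t)).length = 1) then
    [(.blue, n + t, t), (.blue, n + t, n + t)]
  else [(.blue, t, t)]

/-- Keeps the deficient blue components and removes all others. -/
def pendantReplace (n : ℕ) (S O : List (Arc ℕ)) : List (Arc ℕ) :=
  (O.filter fun a => isDeficient (labels n O) O (labelOf (labels n O) a.2.2)) ++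
    (endsOf S).dedup.flatMap (pendantArcs n O (labels n O))

/-- Renames the vertices such that they form an initial segment. -/
def normalize (l : List (Arc ℕ)) : ℕ × ℕ × List (Arc ℕ) :=
  ((endsOf l).dedup.length, 0, l.map fun a =>
    (a.1, (endsOf l).dedup.idxOf a.2.1, (endsOf l).dedup.idxOf a.2.2))

/-- Replaces the blue components and renames the vertices. -/
def kernelize (R : ℕ → List (Arc ℕ) → List (Arc ℕ) → List (Arc ℕ)) (x : ℕ × ℕ × List (Arc ℕ)) :
    ℕ × ℕ × List (Arc ℕ) :=
  normalize (special x.2.1 x.2.2 ++ R x.1 (special x.2.1 x.2.2) (ordinary x.2.1 x.2.2))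

/-! ### Running times -/

namespace Poly

variable {α β : Type} [Encoded α] [Encoded β]

lemma take {f : α → ℕ} {l : α → List β} (hf : Poly f) (hl : Poly l) :
    Poly fun a => (l a).take (f a) := by
  have : (fun a => (l a).take (f a)) =
      fun a => ((l a).reverse.drop ((l a).length - f a)).reverse := by
    funext a
    have := List.take_reverse (xs := (l a).reverse) (i := f a)
    simpa using this
  rw [this]
  exact reverse (drop (sub (length hl) hf) (reverse hl))

lemma eraseIdx {f : α → ℕ} {l : α → List β} (hf : Poly f) (hl : Poly l) :
    Poly fun a => (l a).eraseIdx (f a) := by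
  simp only [List.eraseIdx_eq_take_drop_succ]
  exact append (take hf hl) (drop hf.succ hl)

lemma endsOf {l : α → List (Arc ℕ)} (hl : Poly l) : Poly fun a => NCL.endsOf (l a) :=
  flatMap (f := fun (_ : α) (a : Arc ℕ) => [a.2.1, a.2.2])
    (cons id.snd.snd.fst (cons id.snd.snd.snd nil)) hl

lemma special {e : α → ℕ} {l : α → List (Arc ℕ)} (he : Poly e) (hl : Poly l) :
    Poly fun a => NCL.special (e a) (l a) :=
  append (take (succ zero) (drop he hl))
    (filter (f := fun _ a => !decide (a.1 = .blue)) (not (isBlue id.snd.fst)) (eraseIdx he hl))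

lemma ordinary {e : α → ℕ} {l : α → List (Arc ℕ)} (he : Poly e) (hl : Poly l) :
    Poly fun a => NCL.ordinary (e a) (l a) :=
  filter (f := fun (_ : α) (a : Arc ℕ) => decide (a.1 = .blue)) (isBlue id.snd.fst) (eraseIdx he hl)

lemma labelOf {lab : α → List ℕ} {v : α → ℕ} (hlab : Poly lab) (hv : Poly v) :
    Poly fun a => NCL.labelOf (lab a) (v a) :=
  headD_nat (drop hv hlab)

lemma mergeLabels {lab : α → List ℕ} {b : α → Arc ℕ} (hlab : Poly lab) (hb : Poly b) :
    Poly fun a => NCL.mergeLabels (lab a) (b a) :=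
  map (f := fun a l => if decide (l = NCL.labelOf (lab a) (b a).2.1) then
      NCL.labelOf (lab a) (b a).2.2 else l)
    (cond (eq id.snd (labelOf (hlab.comp id.fst) (hb.comp id.fst).snd.fst))
      (labelOf (hlab.comp id.fst) (hb.comp id.fst).snd.snd) id.snd) hlab

end Poly

lemma labelOf_mem_or (lab : List ℕ) (v : ℕ) : labelOf lab v ∈ lab ∨ labelOf lab v = 0 := by
  rw [labelOf]
  cases h : lab.drop v with
  | nil => exact .inr rfl
  | cons a l => exact .inl (List.mem_of_mem_drop (h ▸ List.mem_cons_self))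

lemma length_foldl_mergeLabels (O : List (Arc ℕ)) (lab : List ℕ) :
    (O.foldl mergeLabels lab).length = lab.length := by
  induction O generalizing lab with
  | nil => rfl
  | cons a O ih => rw [List.foldl_cons, ih, mergeLabels, List.length_map]

/-- Merging introduces no new label except possibly the default `0`. Together with the constant
length, this keeps the intermediate label lists polynomially small in `Poly.labels`. -/
lemma le_of_mem_foldl_mergeLabels {n : ℕ} (O : List (Arc ℕ)) (lab : List ℕ)
    (h : ∀ l ∈ lab, l ≤ n) : ∀ l ∈ O.foldl mergeLabels lab, l ≤ n := by
  induction O generalizing lab with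
  | nil => exact h
  | cons a O ih =>
    refine ih _ fun l hl => ?_
    obtain ⟨k, hk, rfl⟩ := List.mem_map.1 hl
    split
    · rcases labelOf_mem_or lab a.2.2 with h' | h'
      · exact h _ h'
      · omega
    · exact h k hk

namespace Poly

variable {α β : Type} [Encoded α] [Encoded β]

lemma labels {n : α → ℕ} {O : α → List (Arc ℕ)} (hn : Poly n) (hO : Poly O) :
    Poly fun a => NCL.labels (n a) (O a) := by
  refine foldl (step := fun _ lab b => NCL.mergeLabels lab b) (mergeLabels id.snd.fst id.snd.snd)
    hO (range hn) ?_
  obtain ⟨T, hT⟩ := hn.exists_esize_le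
  refine ⟨T * (T + 1) + 1, fun a l _ => ?_⟩
  have h1 := hT a
  rw [esize_nat] at h1
  refine (esize_list_le (B := T.eval (esize a)) fun k hk => ?_).trans ?_
  · have := le_of_mem_foldl_mergeLabels (n := n a) l (List.range (n a))
      (fun k hk => (List.mem_range.1 hk).le) k hk
    rw [esize_nat]
    omega
  · rw [length_foldl_mergeLabels, List.length_range]
    simp only [Polynomial.eval_add, Polynomial.eval_mul, Polynomial.eval_one]
    exact Nat.add_le_add_right (Nat.mul_le_mul (by omega) le_rfl) 1

lemma isDeficient {lab : α → List ℕ} {O : α → List (Arc ℕ)} {l : α → ℕ} (hlab : Poly lab)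
    (hO : Poly O) (hl : Poly l) : Poly fun a => NCL.isDeficient (lab a) (O a) (l a) :=
  lt (length (filter (f := fun a b => decide (NCL.labelOf (lab a) b.2.2 = l a))
      (eq (labelOf (hlab.comp id.fst) id.snd.snd.snd) (hl.comp id.fst)) hO))
    (length (filter (f := fun a k => decide (k = l a)) (eq id.snd (hl.comp id.fst)) hlab))

lemma starArcs {n : α → ℕ} {O : α → List (Arc ℕ)} {lab : α → List ℕ} {t : α → ℕ} (hn : Poly n)
    (hO : Poly O) (hlab : Poly lab) (ht : Poly t) :
    Poly fun a => NCL.starArcs (n a) (O a) (lab a) (t a) :=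
  cons (cond (any (f := fun a b => decide (b.2.2 = t a)) (eq id.snd.snd.snd (ht.comp id.fst)) hO)
      (pair blue (pair (add hn (labelOf hlab ht)) ht))
      (pair blue (pair ht (add hn (labelOf hlab ht)))))
    (cond (isDeficient hlab hO (labelOf hlab ht)) nil
      (cons (pair blue (pair (add hn (labelOf hlab ht)) (add hn (labelOf hlab ht)))) nil))

lemma starReplace {n : α → ℕ} {S O : α → List (Arc ℕ)} (hn : Poly n) (hS : Poly S)
    (hO : Poly O) : Poly fun a => NCL.starReplace (n a) (S a) (O a) :=
  flatMap (f := fun a => NCL.starArcs (n a) (O a) (NCL.labels (n a) (O a)))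
    (starArcs (hn.comp id.fst) (hO.comp id.fst) ((labels hn hO).comp id.fst) id.snd)
    (dedup (endsOf hS))

lemma pendantArcs {n : α → ℕ} {O : α → List (Arc ℕ)} {lab : α → List ℕ} {t : α → ℕ} (hn : Poly n)
    (hO : Poly O) (hlab : Poly lab) (ht : Poly t) :
    Poly fun a => NCL.pendantArcs (n a) (O a) (lab a) (t a) :=
  cond (isDeficient hlab hO (labelOf hlab ht)) nil
    (cond (eq (length (filter (f := fun a v => decide (v = t a)) (eq id.snd (ht.comp id.fst))
        (endsOf hO))) (succ zero))
      (cons (pair blue (pair (add hn ht) ht)) (cons (pair blue (pair (add hn ht) (add hn ht))) nil))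
      (cons (pair blue (pair ht ht)) nil))

lemma pendantReplace {n : α → ℕ} {S O : α → List (Arc ℕ)} (hn : Poly n) (hS : Poly S)
    (hO : Poly O) : Poly fun a => NCL.pendantReplace (n a) (S a) (O a) :=
  append
    (filter (f := fun a b => NCL.isDeficient (NCL.labels (n a) (O a)) (O a)
        (NCL.labelOf (NCL.labels (n a) (O a)) b.2.2))
      (isDeficient ((labels hn hO).comp id.fst) (hO.comp id.fst)
        (labelOf ((labels hn hO).comp id.fst) id.snd.snd.snd)) hO)
    (flatMap (f := fun a => NCL.pendantArcs (n a) (O a) (NCL.labels (n a) (O a)))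
      (pendantArcs (hn.comp id.fst) (hO.comp id.fst) ((labels hn hO).comp id.fst) id.snd)
      (dedup (endsOf hS)))

lemma normalize {l : α → List (Arc ℕ)} (hl : Poly l) : Poly fun a => NCL.normalize (l a) :=
  pair (length (dedup (endsOf hl))) (pair zero
    (map (f := fun a b => (b.1, (NCL.endsOf (l a)).dedup.idxOf b.2.1,
        (NCL.endsOf (l a)).dedup.idxOf b.2.2))
      (pair id.snd.fst (pair (idxOf id.snd.snd.fst ((dedup (endsOf hl)).comp id.fst))
        (idxOf id.snd.snd.snd ((dedup (endsOf hl)).comp id.fst)))) hl))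

lemma kernelize {R : ℕ → List (Arc ℕ) → List (Arc ℕ) → List (Arc ℕ)}
    (hR : Poly fun p : ℕ × List (Arc ℕ) × List (Arc ℕ) => R p.1 p.2.1 p.2.2) :
    Poly (NCL.kernelize R) :=
  have hS := special (id (α := ℕ × ℕ × List (Arc ℕ))).snd.fst id.snd.snd
  normalize (append hS (hR.comp (pair id.fst (pair hS (ordinary id.snd.fst id.snd.snd)))))

end Poly

/-! ### The labels are the components -/

lemma labelOf_mergeLabels {lab : List ℕ} (a : Arc ℕ) {v : ℕ} (hv : v < lab.length) :
    labelOf (mergeLabels lab a) v =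
      if labelOf lab v = labelOf lab a.2.1 then labelOf lab a.2.2 else labelOf lab v := by
  have h : ∀ (l : List ℕ) (hl : v < l.length), labelOf l v = l[v] := by
    intro l hl
    rw [labelOf, List.drop_eq_getElem_cons hl]
    rfl
  rw [h _ (by simpa [mergeLabels] using hv), h _ hv]
  simp [mergeLabels]

lemma labelOf_range {n v : ℕ} (hv : v < n) : labelOf (List.range n) v = v := by
  rw [labelOf, List.drop_eq_getElem_cons (by simpa using hv)]
  simp

/-- Merging treats equal labels alike, so later merges never separate vertices. -/
lemma labelOf_foldl_congr {O : List (Arc ℕ)} {lab : List ℕ} {u v : ℕ} (hu : u < lab.length)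
    (hv : v < lab.length) (h : labelOf lab u = labelOf lab v) :
    labelOf (O.foldl mergeLabels lab) u = labelOf (O.foldl mergeLabels lab) v := by
  induction O generalizing lab with
  | nil => exact h
  | cons a O ih =>
    refine ih (by simpa [mergeLabels] using hu) (by simpa [mergeLabels] using hv) ?_
    rw [labelOf_mergeLabels a hu, labelOf_mergeLabels a hv, h]

lemma labelOf_foldl_of_mem {O : List (Arc ℕ)} {lab : List ℕ}
    (hO : ∀ a ∈ O, a.2.1 < lab.length ∧ a.2.2 < lab.length) :
    ∀ a ∈ O, labelOf (O.foldl mergeLabels lab) a.2.1 = labelOf (O.foldl mergeLabels lab) a.2.2 := by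
  induction O generalizing lab with
  | nil => simp
  | cons a O ih =>
    have hl : (mergeLabels lab a).length = lab.length := by simp [mergeLabels]
    intro b hb
    rcases List.mem_cons.1 hb with rfl | hb
    · obtain ⟨h1, h2⟩ := hO b (by simp)
      refine labelOf_foldl_congr (lab := mergeLabels lab b) (by rwa [hl]) (by rwa [hl]) ?_
      rw [labelOf_mergeLabels b h1, labelOf_mergeLabels b h2]
      simp
    · exact ih (fun c hc => by rw [hl]; exact hO c (by simp [hc])) b hb

/-- Label classes never outgrow components: a set closed under the arcs remains a union of classes
at each merge. -/
lemma mem_iff_of_labelOf_foldl {O : List (Arc ℕ)} {lab : List ℕ} {F : Set ℕ}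
    (hO : ∀ a ∈ O, a.2.1 < lab.length ∧ a.2.2 < lab.length) (hF : ∀ a ∈ O, a.2.1 ∈ F ↔ a.2.2 ∈ F)
    (h : ∀ u < lab.length, ∀ v < lab.length, labelOf lab u = labelOf lab v → (u ∈ F ↔ v ∈ F)) :
    ∀ u < lab.length, ∀ v < lab.length,
      labelOf (O.foldl mergeLabels lab) u = labelOf (O.foldl mergeLabels lab) v →
        (u ∈ F ↔ v ∈ F) := by
  induction O generalizing lab with
  | nil => exact h
  | cons a O ih =>
    have hl : (mergeLabels lab a).length = lab.length := by simp [mergeLabels]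
    have := ih (lab := mergeLabels lab a) (fun c hc => by rw [hl]; exact hO c (by simp [hc]))
      (fun c hc => hF c (by simp [hc])) (by
        rw [hl]
        intro u hu v hv huv
        obtain ⟨h1, h2⟩ := hO a (by simp)
        have haF := hF a (by simp)
        rw [labelOf_mergeLabels a hu, labelOf_mergeLabels a hv] at huv
        -- A relabelled vertex shared its label with the tail of `a` and now has that of the head;
        -- `haF` passes membership in `F` between the two.
        split_ifs at huv with hu' hv' hv'
        · rw [h u hu _ h1 hu', h v hv _ h1 hv']
        · rw [h u hu _ h1 hu', ← h _ h2 v hv huv, haF]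
        · rw [h v hv _ h1 hv', h u hu _ h2 huv, haF]
        · exact h u hu v hv huv)
    rw [hl] at this
    exact this

lemma components_labels {n : ℕ} {O : List (Arc ℕ)} (hb : ∀ a ∈ O, a.1 = .blue)
    (hO : ∀ a ∈ O, a.2.1 < n ∧ a.2.2 < n) :
    Components (Finset.range n) (labelOf (labels n O)) (O : Multiset (Arc ℕ)) := by
  have hlen : (List.range n).length = n := List.length_range
  refine ⟨hb, fun a ha => by simpa using hO a ha,
    labelOf_foldl_of_mem (by simpa only [hlen] using hO), fun F hF u hu v hv huv => ?_⟩
  refine (mem_iff_of_labelOf_foldl (by simpa only [hlen] using hO) hF ?_ u (by simpa using hu) v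
    (by simpa using hv) huv).1
  rw [hlen]
  intro x hx y hy hxy
  rw [labelOf_range hx, labelOf_range hy] at hxy
  rw [hxy]

lemma isDeficient_iff {n : ℕ} {O : List (Arc ℕ)} {l : ℕ} :
    isDeficient (labels n O) O l = true ↔
      Deficient (Finset.range n) (labelOf (labels n O)) (O : Multiset (Arc ℕ)) l := by
  have hlen : (labels n O).length = n := by
    rw [labels, length_foldl_mergeLabels, List.length_range]
  have hmap : labels n O = (List.range n).map (labelOf (labels n O)) := by
    refine List.ext_getElem (by simp [hlen]) fun i h1 h2 => ?_
    rw [List.getElem_map, List.getElem_range, labelOf, List.drop_eq_getElem_cons h1]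
    rfl
  have h1 : ((labels n O).filter fun k => decide (k = l)).length =
      ((Finset.range n).filter fun v => labelOf (labels n O) v = l).card := by
    conv_lhs => rw [hmap, List.filter_map, List.length_map]
    rfl
  rw [isDeficient, h1, decide_eq_true_iff, Deficient, labelArcs, Multiset.filter_coe,
    Multiset.coe_card]

/-! ### Renumbering -/

lemma mem_endsOf {l : List (Arc ℕ)} {v : ℕ} : v ∈ endsOf l ↔ ∃ a ∈ l, v = a.2.1 ∨ v = a.2.2 := by
  simp [endsOf]

lemma endsOf_append (l l' : List (Arc ℕ)) : endsOf (l ++ l') = endsOf l ++ endsOf l' := by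
  simp [endsOf]

lemma length_endsOf (l : List (Arc ℕ)) : (endsOf l).length = 2 * l.length := by
  induction l with
  | nil => rfl
  | cons a l ih => simp [endsOf] at *; omega

lemma within_endsOf (l : List (Arc ℕ)) :
    Within ((endsOf l).toFinset : Set ℕ) (l : Multiset (Arc ℕ)) := by
  intro a ha
  simp only [Finset.mem_coe, List.mem_toFinset, mem_endsOf]
  exact ⟨⟨a, ha, .inl rfl⟩, ⟨a, ha, .inr rfl⟩⟩

lemma idxOf_injOn (K : List ℕ) : Set.InjOn K.idxOf (K.toFinset : Set ℕ) := by
  intro u hu v hv h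
  simp only [Finset.mem_coe, List.mem_toFinset] at hu hv
  exact (List.idxOf_inj hu).1 h

lemma image_idxOf_dedup (K : List ℕ) :
    K.toFinset.image K.dedup.idxOf = Finset.range K.dedup.length := by
  ext i
  simp only [Finset.mem_image, List.mem_toFinset, Finset.mem_range]
  constructor
  · rintro ⟨v, hv, rfl⟩
    exact List.idxOf_lt_length_of_mem (List.mem_dedup.2 hv)
  · intro hi
    exact ⟨K.dedup[i], List.mem_dedup.1 (List.getElem_mem hi), (List.nodup_dedup K).idxOf_getElem i hi⟩

/-- The distinguished arc stands first in the list, whence the edge index `0` in `normalize`. Only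
ends of arcs are kept as vertices, and their position among these ends is an injective renaming onto
an initial segment. -/
lemma exists_enc_eq_normalize {a : Arc ℕ} {l : List (Arc ℕ)}
    (hf : FeasOn (endsOf (a :: l)).toFinset (a :: l : List (Arc ℕ))) :
    ∃ I : C2EInstance, I.enc = Encoded.enc (normalize (a :: l)) ∧
      (I.Yes ↔ Changeable (BothFeas (endsOf (a :: l)).toFinset) (a, (l : Multiset (Arc ℕ)))) ∧
      I.n = (endsOf (a :: l)).dedup.length ∧
      I.arcList = (a :: l).map (mapArc (endsOf (a :: l)).dedup.idxOf) := by
  set K := endsOf (a :: l) with hK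
  have hinj : Set.InjOn K.dedup.idxOf (K.toFinset : Set ℕ) := by
    have := idxOf_injOn K.dedup
    rwa [show K.dedup.toFinset = K.toFinset by ext; simp] at this
  have hw : Within (K.toFinset : Set ℕ) ((a :: l : List (Arc ℕ)) : Multiset (Arc ℕ)) :=
    within_endsOf _
  have hf' := (feasOn_map hinj hw).2 hf
  rw [image_idxOf_dedup, Multiset.map_coe] at hf'
  have hlt : ∀ b ∈ (a :: l).map (mapArc K.dedup.idxOf),
      b.2.1 < K.dedup.length ∧ b.2.2 < K.dedup.length := by
    intro b hb
    obtain ⟨c, hc, rfl⟩ := List.mem_map.1 hb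
    have := hw c hc
    simp only [Finset.mem_coe, List.mem_toFinset] at this
    exact ⟨List.idxOf_lt_length_of_mem (List.mem_dedup.2 this.1),
      List.idxOf_lt_length_of_mem (List.mem_dedup.2 this.2)⟩
  obtain ⟨I, hn, he, hI⟩ := C2EInstance.exists_arcList_eq (e := 0) (by simp) hlt hf'
  refine ⟨I, ?_, ?_, hn, hI⟩
  · rw [I.enc_eq, hn, he, hI]
    rfl
  · have hs : I.state = mapState K.dedup.idxOf (a, (l : Multiset (Arc ℕ))) := by
      refine Prod.ext ?_ ?_
      · rw [I.state_fst]
        simp [he, hI, mapState]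
      · rw [I.state_snd]
        simp [he, hI, mapState]
    rw [I.yes_iff, hs, hn, ← image_idxOf_dedup]
    exact changeable_map hinj hw

/-! ### Special and ordinary arcs of an instance -/

namespace C2EInstance

/-- The arc of the distinguished edge and the red arcs. -/
def specialArcs (I : C2EInstance) : List (Arc ℕ) := special I.e I.arcList

/-- The other blue arcs. -/
def ordinaryArcs (I : C2EInstance) : List (Arc ℕ) := ordinary I.e I.arcList

/-- The first entry exists since `e` is a valid index. The other special arcs are all red, which
bounds the number of special arcs by `k + 1`, whatever the color of `e`. -/
lemma exists_specialArcs_eq (I : C2EInstance) : ∃ r : List (Arc ℕ),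
    I.specialArcs = I.state.1 :: r ∧ I.state.2 = (r : Multiset (Arc ℕ)) + I.ordinaryArcs ∧
      r.length ≤ I.G.numRed := by
  refine ⟨(I.arcList.eraseIdx I.e).filter fun a => !decide (a.1 = .blue), ?_, ?_, ?_⟩
  · rw [specialArcs, special, List.drop_eq_getElem_cons I.e_lt_length, state_fst]
    rfl
  · rw [state_snd, ordinaryArcs, ordinary, add_comm]
    have := Multiset.filter_add_not (fun a : Arc ℕ => a.1 = .blue)
      (I.arcList.eraseIdx I.e : Multiset (Arc ℕ))
    rw [Multiset.filter_coe, Multiset.filter_coe] at this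
    rw [← this]
    simp
  · rw [numRed_eq]
    have h : (fun a : Arc ℕ => !decide (a.1 = .blue)) = fun a => decide (a.1 = .red) := by
      funext a
      cases a.1 <;> rfl
    rw [h]
    exact ((List.eraseIdx_sublist _ _).filter _).length_le

lemma coe_arcList (I : C2EInstance) :
    (I.arcList : Multiset (Arc ℕ)) = (I.specialArcs : Multiset (Arc ℕ)) + I.ordinaryArcs := by
  obtain ⟨r, h1, h2, -⟩ := I.exists_specialArcs_eq
  rw [← I.arcs_state, arcs, h2, h1, ← Multiset.cons_coe, Multiset.cons_add]

lemma mem_arcList (I : C2EInstance) {a : Arc ℕ} :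
    a ∈ I.arcList ↔ a ∈ I.specialArcs ∨ a ∈ I.ordinaryArcs := by
  have := congrArg (a ∈ ·) I.coe_arcList
  simpa using this

lemma blue_of_mem (I : C2EInstance) : ∀ a ∈ I.ordinaryArcs, a.1 = .blue := by
  intro a ha
  simpa using (List.mem_filter.1 ha).2

lemma components (I : C2EInstance) : Components (Finset.range I.n)
    (labelOf (labels I.n I.ordinaryArcs)) (I.ordinaryArcs : Multiset (Arc ℕ)) :=
  components_labels I.blue_of_mem fun a ha => I.within a (I.mem_arcList.2 (.inr ha))

lemma lt_of_mem_endsOf (I : C2EInstance) {t : ℕ} (ht : t ∈ endsOf I.specialArcs) : t < I.n := by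
  obtain ⟨a, ha, rfl | rfl⟩ := mem_endsOf.1 ht
  · exact (I.within a (I.mem_arcList.2 (.inl ha))).1
  · exact (I.within a (I.mem_arcList.2 (.inl ha))).2

/-- An instance that is obtained by replacing the blue components. -/
lemma exists_enc_eq_kernelize (I : C2EInstance) {L : Type} [DecidableEq L]
    (R : ℕ → List (Arc ℕ) → List (Arc ℕ) → List (Arc ℕ)) {Q : List (Arc ℕ)}
    (hQ : Q = R I.n I.specialArcs I.ordinaryArcs) {lab : ℕ → L}
    (hc : Components (endsOf (I.specialArcs ++ Q)).toFinset lab (Q : Multiset (Arc ℕ)))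
    (hf : FeasOn (endsOf (I.specialArcs ++ Q)).toFinset
      ((I.specialArcs : Multiset (Arc ℕ)) + (Q : Multiset (Arc ℕ))))
    (hX : ∀ X ⊆ {t | t ∈ endsOf I.specialArcs},
      Hits (Finset.range I.n) (labelOf (labels I.n I.ordinaryArcs))
        (Deficient (Finset.range I.n) (labelOf (labels I.n I.ordinaryArcs))
          (I.ordinaryArcs : Multiset (Arc ℕ))) X ↔
      Hits (endsOf (I.specialArcs ++ Q)).toFinset lab
        (Deficient (endsOf (I.specialArcs ++ Q)).toFinset lab (Q : Multiset (Arc ℕ))) X) :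
    ∃ J : C2EInstance, J.enc = Encoded.enc (kernelize R (I.n, (I.e : ℕ), I.arcList)) ∧
      (J.Yes ↔ I.Yes) ∧ J.n = (endsOf (I.specialArcs ++ Q)).dedup.length ∧
      J.arcList = (I.specialArcs ++ Q).map
        (mapArc (endsOf (I.specialArcs ++ Q)).dedup.idxOf) := by
  obtain ⟨r, h1, h2, -⟩ := I.exists_specialArcs_eq
  have hk : kernelize R (I.n, (I.e : ℕ), I.arcList) = normalize (I.specialArcs ++ Q) := by
    rw [hQ]
    rfl
  have harcs : arcs (I.state.1, (r : Multiset (Arc ℕ))) = (I.specialArcs : Multiset (Arc ℕ)) := by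
    rw [h1, arcs, Multiset.cons_coe]
  have hT : Within {t | t ∈ endsOf I.specialArcs} (arcs (I.state.1, (r : Multiset (Arc ℕ)))) := by
    rw [harcs]
    intro a ha
    exact ⟨mem_endsOf.2 ⟨a, ha, .inl rfl⟩, mem_endsOf.2 ⟨a, ha, .inr rfl⟩⟩
  have hI := I.feasOn
  rw [I.coe_arcList] at hI
  have key := changeable_congr I.components hc (s := (I.state.1, (r : Multiset (Arc ℕ))))
    (by rwa [harcs]) (by rwa [harcs]) hT hX
  have hs : (I.state.1, (r : Multiset (Arc ℕ)) + (I.ordinaryArcs : Multiset (Arc ℕ))) = I.state := by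
    rw [← h2]
  dsimp only at key
  rw [hs, ← I.yes_iff, Multiset.coe_add] at key
  rw [hk, key]
  rw [Multiset.coe_add, h1] at hf
  rw [h1]
  exact exists_enc_eq_normalize hf

end C2EInstance

lemma two_le_inWeight_of_blue {V : Type} [DecidableEq V] {M : Multiset (Arc V)} {a : Arc V}
    (ha : a ∈ M) (hb : a.1 = .blue) : 2 ≤ inWeight M a.2.2 := by
  obtain ⟨K, rfl⟩ := Multiset.exists_cons_of_mem ha
  rw [inWeight_cons, if_pos rfl, hb]
  exact Nat.le_add_right _ _

lemma two_le_inWeight_of_inDeg_eq_zero {V L : Type} [DecidableEq V] [DecidableEq L] {U : Finset V}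
    {lab : V → L} {S O : Multiset (Arc V)} (hO : Components U lab O) {t : V}
    (h : 2 ≤ inWeight (S + O) t) (h0 : inDeg O t = 0) : 2 ≤ inWeight S t := by
  rw [inWeight_add, inWeight_eq_of_blue hO.blue, h0] at h
  exact h

lemma length_filter_flatMap {α β : Type} (p : β → Bool) (f : α → List β) (l : List α) :
    ((l.flatMap f).filter p).length = (l.map fun a => ((f a).filter p).length).sum := by
  induction l with
  | nil => rfl
  | cons a l ih => simp [ih]

namespace C2EInstance

variable (I : C2EInstance)

/-- The labels of the blue components. -/
def lab (v : ℕ) : ℕ := labelOf (labels I.n I.ordinaryArcs) v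

/-- The labels of the blue components with fewer arcs than vertices. -/
def IsDef (l : ℕ) : Prop :=
  Deficient (Finset.range I.n) I.lab (I.ordinaryArcs : Multiset (Arc ℕ)) l

lemma isDeficient_iff_isDef {l : ℕ} :
    isDeficient (labels I.n I.ordinaryArcs) I.ordinaryArcs l = true ↔ I.IsDef l :=
  isDeficient_iff

lemma components_lab :
    Components (Finset.range I.n) I.lab (I.ordinaryArcs : Multiset (Arc ℕ)) := I.components

lemma two_le_inWeight {v : ℕ} (hv : v < I.n) :
    2 ≤ inWeight ((I.specialArcs : Multiset (Arc ℕ)) + (I.ordinaryArcs : Multiset (Arc ℕ))) v := by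
  rw [← I.coe_arcList]
  exact I.feasOn v (Finset.mem_range.2 hv)

/-- A vertex that no ordinary arc enters relies on special arcs, so it is a terminal. In particular
every deficient component contains a terminal. -/
lemma mem_endsOf_of_inDeg_eq_zero {v : ℕ} (hv : v < I.n)
    (h : inDeg (I.ordinaryArcs : Multiset (Arc ℕ)) v = 0) :
    2 ≤ inWeight (I.specialArcs : Multiset (Arc ℕ)) v ∧ v ∈ endsOf I.specialArcs := by
  have h2 := two_le_inWeight_of_inDeg_eq_zero I.components_lab (I.two_le_inWeight hv) h
  obtain ⟨a, ha, rfl⟩ := inWeight_pos_of_mem (zero_lt_two.trans_le h2)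
  exact ⟨h2, mem_endsOf.2 ⟨a, ha, .inr rfl⟩⟩

lemma IsDef.exists_terminal {I : C2EInstance} {l : ℕ} (h : I.IsDef l) :
    ∃ t ∈ endsOf I.specialArcs, I.lab t = l ∧
      inDeg (I.ordinaryArcs : Multiset (Arc ℕ)) t = 0 := by
  obtain ⟨t, ht, hl, h0⟩ := I.components_lab.exists_inDeg_eq_zero h
  exact ⟨t, (I.mem_endsOf_of_inDeg_eq_zero (Finset.mem_range.1 ht) h0).2, hl, h0⟩

/-! ### Stars -/

/-- The arcs of the stars. -/
def stars : List (Arc ℕ) := starReplace I.n I.specialArcs I.ordinaryArcs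

/-- The labels of the stars. -/
def starLab (v : ℕ) : ℕ := if v < I.n then I.lab v else v - I.n

lemma starLab_center (l : ℕ) : I.starLab (I.n + l) = l := by
  simp [starLab]

lemma starLab_of_mem {t : ℕ} (ht : t ∈ endsOf I.specialArcs) : I.starLab t = I.lab t := by
  simp [starLab, I.lt_of_mem_endsOf ht]

lemma mem_stars {a : Arc ℕ} : a ∈ I.stars ↔ ∃ t ∈ endsOf I.specialArcs,
    (a = (.blue, I.n + I.lab t, t) ∧ inDeg (I.ordinaryArcs : Multiset (Arc ℕ)) t ≠ 0) ∨
    (a = (.blue, t, I.n + I.lab t) ∧ inDeg (I.ordinaryArcs : Multiset (Arc ℕ)) t = 0) ∨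
    (a = (.blue, I.n + I.lab t, I.n + I.lab t) ∧ ¬I.IsDef (I.lab t)) := by
  have h : ∀ t, (I.ordinaryArcs.any fun a => decide (a.2.2 = t)) = true ↔
      inDeg (I.ordinaryArcs : Multiset (Arc ℕ)) t ≠ 0 := by
    intro t
    rw [List.any_eq_true, ← Nat.pos_iff_ne_zero]
    constructor
    · rintro ⟨b, hb, hbt⟩
      rw [← of_decide_eq_true hbt]
      exact inDeg_pos hb
    · intro h
      obtain ⟨b, hb, hbt⟩ := exists_of_inDeg_pos h
      exact ⟨b, hb, decide_eq_true hbt⟩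
  simp only [stars, starReplace, List.mem_flatMap, List.mem_dedup, starArcs, List.mem_cons]
  refine exists_congr fun t => and_congr_right fun _ => ?_
  have hd : isDeficient (labels I.n I.ordinaryArcs) I.ordinaryArcs
      (I.lab t) = true ↔ I.IsDef (I.lab t) := I.isDeficient_iff_isDef
  rw [show labelOf (labels I.n I.ordinaryArcs) t = I.lab t from rfl]
  simp only [h t]
  by_cases h2 : I.IsDef (I.lab t)
  · have hd' := hd.2 h2
    by_cases h1 : inDeg (I.ordinaryArcs : Multiset (Arc ℕ)) t = 0 <;> simp [h1, h2, hd']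
  · have hd' := Bool.eq_false_iff.2 (mt hd.1 h2)
    by_cases h1 : inDeg (I.ordinaryArcs : Multiset (Arc ℕ)) t = 0 <;> simp [h1, h2, hd']

lemma mem_ends_stars {v : ℕ} : v ∈ endsOf (I.specialArcs ++ I.stars) ↔
    v ∈ endsOf I.specialArcs ∨ ∃ t ∈ endsOf I.specialArcs, v = I.n + I.lab t := by
  rw [endsOf_append, List.mem_append, mem_endsOf (l := I.stars)]
  constructor
  · rintro (h | ⟨a, ha, h⟩)
    · exact .inl h
    · obtain ⟨t, ht, ⟨rfl, -⟩ | ⟨rfl, -⟩ | ⟨rfl, -⟩⟩ := I.mem_stars.1 ha <;>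
        rcases h with rfl | rfl <;> first | exact .inl ht | exact .inr ⟨t, ht, rfl⟩
  · rintro (h | ⟨t, ht, rfl⟩)
    · exact .inl h
    · by_cases h0 : inDeg (I.ordinaryArcs : Multiset (Arc ℕ)) t = 0
      · exact .inr ⟨_, I.mem_stars.2 ⟨t, ht, .inr (.inl ⟨rfl, h0⟩)⟩, .inr rfl⟩
      · exact .inr ⟨_, I.mem_stars.2 ⟨t, ht, .inl ⟨rfl, h0⟩⟩, .inl rfl⟩

lemma mem_iff_center_mem {F : Set ℕ} (hF : ∀ a ∈ I.stars, a.2.1 ∈ F ↔ a.2.2 ∈ F) {t : ℕ}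
    (ht : t ∈ endsOf I.specialArcs) : t ∈ F ↔ I.n + I.lab t ∈ F := by
  by_cases h0 : inDeg (I.ordinaryArcs : Multiset (Arc ℕ)) t = 0
  · exact hF _ (I.mem_stars.2 ⟨t, ht, .inr (.inl ⟨rfl, h0⟩)⟩)
  · exact (hF _ (I.mem_stars.2 ⟨t, ht, .inl ⟨rfl, h0⟩⟩)).symm

lemma components_stars : Components (endsOf (I.specialArcs ++ I.stars)).toFinset I.starLab
    (I.stars : Multiset (Arc ℕ)) := by
  refine ⟨?_, ?_, ?_, ?_⟩
  · intro a ha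
    obtain ⟨t, ht, ⟨rfl, -⟩ | ⟨rfl, -⟩ | ⟨rfl, -⟩⟩ := I.mem_stars.1 ha <;> rfl
  · exact fun a ha => within_endsOf (I.specialArcs ++ I.stars) a
      (List.mem_append_right _ ha)
  · intro a ha
    obtain ⟨t, ht, ⟨rfl, -⟩ | ⟨rfl, -⟩ | ⟨rfl, -⟩⟩ := I.mem_stars.1 ha <;>
      simp [starLab_center, I.starLab_of_mem ht]
  · intro F hF
    have key : ∀ u ∈ (endsOf (I.specialArcs ++ I.stars)).toFinset,
        u ∈ F ↔ I.n + I.starLab u ∈ F := by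
      intro u hu
      rw [List.mem_toFinset, mem_ends_stars] at hu
      rcases hu with hu | ⟨t, ht, rfl⟩
      · rw [I.starLab_of_mem hu]
        exact I.mem_iff_center_mem hF hu
      · rw [starLab_center]
    intro u hu v hv huv h
    rwa [key v hv, ← huv, ← key u hu]

/-- A terminal keeps being served as before: by its star arc if an ordinary arc entered it, and by
special arcs otherwise. The center is served by its loop or, in a deficient component, by a terminal
that no ordinary arc enters. -/
lemma feasOn_stars : FeasOn (endsOf (I.specialArcs ++ I.stars)).toFinset
    ((I.specialArcs : Multiset (Arc ℕ)) + (I.stars : Multiset (Arc ℕ))) := by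
  have hblue : ∀ a ∈ I.stars, 2 ≤ inWeight ((I.specialArcs : Multiset (Arc ℕ)) +
      (I.stars : Multiset (Arc ℕ))) a.2.2 := fun a ha =>
    two_le_inWeight_of_blue (Multiset.mem_add.2 (.inr ha)) (I.components_stars.blue a ha)
  intro v hv
  rw [List.mem_toFinset, mem_ends_stars] at hv
  rcases hv with hv | ⟨t, ht, rfl⟩
  · by_cases h0 : inDeg (I.ordinaryArcs : Multiset (Arc ℕ)) v = 0
    · rw [inWeight_add]
      exact (I.mem_endsOf_of_inDeg_eq_zero (I.lt_of_mem_endsOf hv) h0).1.trans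
        (Nat.le_add_right _ _)
    · exact hblue _ (I.mem_stars.2 ⟨v, hv, .inl ⟨rfl, h0⟩⟩)
  · by_cases hd : I.IsDef (I.lab t)
    · obtain ⟨u, hu, hut, h0⟩ := hd.exists_terminal
      rw [← hut]
      exact hblue _ (I.mem_stars.2 ⟨u, hu, .inr (.inl ⟨rfl, h0⟩)⟩)
    · exact hblue _ (I.mem_stars.2 ⟨t, ht, .inr (.inr ⟨rfl, hd⟩)⟩)

open Classical in
-- Each terminal contributes its star edge and, unless the component is deficient, one loop at the
-- center.
lemma labelArcs_stars (l : ℕ) : labelArcs I.starLab (I.stars : Multiset (Arc ℕ)) l =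
    ((endsOf I.specialArcs).dedup.filter fun t => decide (I.lab t = l)).length *
      if I.IsDef l then 1 else 2 := by
  rw [labelArcs, Multiset.filter_coe, Multiset.coe_card, stars, starReplace, length_filter_flatMap]
  have hT : ∀ t ∈ (endsOf I.specialArcs).dedup, t ∈ endsOf I.specialArcs :=
    fun t ht => List.mem_dedup.1 ht
  generalize (endsOf I.specialArcs).dedup = T at hT
  induction T with
  | nil => simp
  | cons t T ih =>
    have ht := hT t List.mem_cons_self
    rw [List.map_cons, List.sum_cons, ih fun t ht => hT t (List.mem_cons_of_mem _ ht)]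
    have hd : isDeficient (labels I.n I.ordinaryArcs) I.ordinaryArcs
      (labelOf (labels I.n I.ordinaryArcs) t) = true ↔ I.IsDef (I.lab t) := I.isDeficient_iff_isDef
    have hlt : I.starLab (if (I.ordinaryArcs.any fun a => decide (a.2.2 = t)) = true then
        ((.blue, I.n + labelOf (labels I.n I.ordinaryArcs) t, t) : Arc ℕ)
        else (.blue, t, I.n + labelOf (labels I.n I.ordinaryArcs) t)).2.2 = I.lab t := by
      split
      · exact I.starLab_of_mem ht
      · exact I.starLab_center _
    have hc : I.starLab (I.n + labelOf (labels I.n I.ordinaryArcs) t) = I.lab t :=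
      I.starLab_center _
    rw [starArcs, List.filter_cons, hlt, List.filter_cons]
    by_cases hl : I.lab t = l
    · subst hl
      by_cases hd' : I.IsDef (I.lab t)
      · simp [hd, hd', add_comm]
      · simp [hd, hd', hc, add_mul, add_comm]
    · by_cases hd' : I.IsDef (I.lab t)
      · simp [hl, hd, hd']
      · simp [hl, hd, hd', hc]

/-- With `a > 0` terminals, a star has `a + 1` vertices and either `a` or `2 * a ≥ a + 1` edges.
Without terminals nothing remains of the component, which then was not deficient. -/
lemma deficient_stars_iff {l : ℕ} : Deficient (endsOf (I.specialArcs ++ I.stars)).toFinset I.starLab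
    (I.stars : Multiset (Arc ℕ)) l ↔ I.IsDef l := by
  classical
  set A := (endsOf I.specialArcs).dedup.filter fun t => decide (I.lab t = l) with hA
  have hAm : ∀ t, t ∈ A ↔ t ∈ endsOf I.specialArcs ∧ I.lab t = l := by
    intro t
    simp [hA]
  have hU : ∀ v, v ∈ (endsOf (I.specialArcs ++ I.stars)).toFinset.filter
      (fun v => I.starLab v = l) ↔ v ∈ A ∨ A ≠ [] ∧ v = I.n + l := by
    intro v
    rw [Finset.mem_filter, List.mem_toFinset, mem_ends_stars, hAm]
    constructor
    · rintro ⟨hv | ⟨t, ht, rfl⟩, hl⟩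
      · exact .inl ⟨hv, by rwa [I.starLab_of_mem hv] at hl⟩
      · rw [starLab_center] at hl
        exact .inr ⟨List.ne_nil_of_mem ((hAm t).2 ⟨ht, hl⟩), by rw [hl]⟩
    · rintro (⟨hv, hl⟩ | ⟨hne, rfl⟩)
      · exact ⟨.inl hv, by rwa [I.starLab_of_mem hv]⟩
      · obtain ⟨t, ht⟩ := List.exists_mem_of_ne_nil _ hne
        obtain ⟨ht, htl⟩ := (hAm t).1 ht
        exact ⟨.inr ⟨t, ht, by rw [htl]⟩, I.starLab_center _⟩
  have hnd : A.Nodup := (List.nodup_dedup _).filter _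
  rw [Deficient, labelArcs_stars, ← hA]
  by_cases hne : A = []
  · have : ¬I.IsDef l := fun h => by
      obtain ⟨t, ht, htl, -⟩ := h.exists_terminal
      have := (hAm t).2 ⟨ht, htl⟩
      rw [hne] at this
      simp at this
    have h0 : (endsOf (I.specialArcs ++ I.stars)).toFinset.filter (fun v => I.starLab v = l) = ∅ := by
      ext v
      rw [hU]
      simp [hne]
    simp [this, h0]
  · have hins : (endsOf (I.specialArcs ++ I.stars)).toFinset.filter (fun v => I.starLab v = l) =
        insert (I.n + l) A.toFinset := by
      ext v
      rw [hU]
      simp [hne, or_comm]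
    have hnot : I.n + l ∉ A.toFinset := by
      rw [List.mem_toFinset, hAm]
      rintro ⟨h, -⟩
      have := I.lt_of_mem_endsOf h
      omega
    rw [hins, Finset.card_insert_of_notMem hnot, List.toFinset_card_of_nodup hnd]
    have := List.length_pos_iff.2 hne
    by_cases h : I.IsDef l
    · simp [h]
    · simp only [h, if_false, iff_false]
      omega

lemma hits_stars (X : Set ℕ) (hX : X ⊆ {t | t ∈ endsOf I.specialArcs}) :
    Hits (Finset.range I.n) I.lab I.IsDef X ↔
      Hits (endsOf (I.specialArcs ++ I.stars)).toFinset I.starLab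
        (Deficient (endsOf (I.specialArcs ++ I.stars)).toFinset I.starLab
          (I.stars : Multiset (Arc ℕ))) X := by
  refine forall_congr' fun l => ?_
  rw [deficient_stars_iff]
  refine imp_congr_right fun _ => exists_congr fun t => ?_
  constructor
  · rintro ⟨-, hl, ht⟩
    exact ⟨by rw [List.mem_toFinset, mem_ends_stars]; exact .inl (hX ht),
      by rwa [I.starLab_of_mem (hX ht)], ht⟩
  · rintro ⟨-, hl, ht⟩
    exact ⟨Finset.mem_range.2 (I.lt_of_mem_endsOf (hX ht)),
      by rwa [I.starLab_of_mem (hX ht)] at hl, ht⟩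

lemma length_stars_le : I.stars.length ≤ 4 * I.specialArcs.length := by
  have h : (endsOf I.specialArcs).dedup.length ≤ 2 * I.specialArcs.length := by
    rw [← length_endsOf]
    exact (List.dedup_sublist _).length_le
  have : I.stars.length ≤ (endsOf I.specialArcs).dedup.length * 2 := by
    rw [stars, starReplace, List.length_flatMap]
    refine (List.sum_le_card_nsmul _ 2 fun k hk => ?_).trans (by simp)
    obtain ⟨t, -, rfl⟩ := List.mem_map.1 hk
    rw [starArcs]
    split_ifs <;> simp
  omega

end C2EInstance

/-- The map on instances is only known through choice, but its encoding is prescribed by a function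
on lists, and that suffices for a program. -/
lemma polyTime_of_enc_eq_kernelize {R : ℕ → List (Arc ℕ) → List (Arc ℕ) → List (Arc ℕ)}
    (hR : Poly fun p : ℕ × List (Arc ℕ) × List (Arc ℕ) => R p.1 p.2.1 p.2.2) {α : Type}
    (i : α → C2EInstance) (f : α → α)
    (hf : ∀ a, (i (f a)).enc =
      Encoded.enc (kernelize R ((i a).n, ((i a).e : ℕ), (i a).arcList))) :
    PolyTime (fun a => (i a).enc) (fun a => (i a).enc) f := by
  obtain ⟨p, T, hp⟩ := Poly.kernelize hR
  refine ⟨p, T, fun a => ?_⟩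
  have := hp ((i a).n, ((i a).e : ℕ), (i a).arcList)
  rwa [← hf, ← C2EInstance.enc_eq] at this

lemma isBigO_mul_add_one (c : ℕ) :
    (fun k : ℕ => ((c * (k + 1) : ℕ) : ℝ)) =O[Filter.atTop] (fun k : ℕ => (k : ℝ)) := by
  -- For `k ≥ 1`, `k + 1 ≤ 2 * k`.
  refine Asymptotics.IsBigO.of_bound (2 * c) (Filter.eventually_atTop.2 ⟨1, fun k hk => ?_⟩)
  have : (1 : ℝ) ≤ k := by exact_mod_cast hk
  have hc : (0 : ℝ) ≤ c := by positivity
  rw [Real.norm_of_nonneg (by positivity), Real.norm_of_nonneg (by positivity)]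
  push_cast
  nlinarith

lemma C2EByRedEdges_admitsLinearKernel : C2EByRedEdges.AdmitsLinearKernel := by
  -- With `s ≤ k + 1` special arcs there are at most `4 * s` star arcs, hence at most `5 * s` edges
  -- and twice as many vertices.
  have h : ∀ I : C2EInstance, ∃ J : C2EInstance,
      J.enc = Encoded.enc (kernelize starReplace (I.n, (I.e : ℕ), I.arcList)) ∧
      (J.Yes ↔ I.Yes) ∧ J.size ≤ 15 * (I.G.numRed + 1) ∧ J.G.numRed ≤ 15 * (I.G.numRed + 1) := by
    intro I
    obtain ⟨J, h1, h2, h3, h4⟩ := I.exists_enc_eq_kernelize starReplace (Q := I.stars) rfl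
      I.components_stars I.feasOn_stars I.hits_stars
    obtain ⟨r, hr, -, hlen⟩ := I.exists_specialArcs_eq
    have hs : I.specialArcs.length ≤ I.G.numRed + 1 := by simp [hr, hlen]
    have hst := I.length_stars_le
    have hm : J.m = I.specialArcs.length + I.stars.length := by
      rw [← J.length_arcList, h4]
      simp
    have hn : J.n ≤ 2 * J.m := by
      rw [h3, hm, ← List.length_append, ← length_endsOf]
      exact (List.dedup_sublist _).length_le
    have hred : J.G.numRed ≤ J.m := by
      rw [J.numRed_eq, ← J.length_arcList]
      exact List.length_filter_le _ _
    refine ⟨J, h1, h2, ?_, ?_⟩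
    · rw [C2EInstance.size]
      omega
    · omega
  choose f h1 h2 h3 h4 using h
  refine ⟨f, ?_, h2, fun k => 15 * (k + 1), ?_, fun I => ⟨h3 I, h4 I⟩⟩
  · exact polyTime_of_enc_eq_kernelize (Poly.starReplace Poly.id.fst Poly.id.snd.fst Poly.id.snd.snd)
      (fun I => I) f h1
  · exact isBigO_mul_add_one 15

/-! ## AND/OR graphs -/

section

variable {V : Type} [DecidableEq V]

lemma multiDegree_cons (a : Arc V) (M : Multiset (Arc V)) (c : Color) (v : V) :
    multiDegree (a ::ₘ M) c v = (if a.1 = c ∧ a.2.1 = v then 1 else 0) +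
      (if a.1 = c ∧ a.2.2 = v then 1 else 0) + multiDegree M c v := by
  simp only [multiDegree, ← Multiset.countP_eq_card_filter, Multiset.countP_cons]
  omega

lemma multiDegree_zero (c : Color) (v : V) : multiDegree (0 : Multiset (Arc V)) c v = 0 := rfl

lemma multiDegree_add (M N : Multiset (Arc V)) (c : Color) (v : V) :
    multiDegree (M + N) c v = multiDegree M c v + multiDegree N c v := by
  simp only [multiDegree, Multiset.filter_add, Multiset.card_add]
  omega

lemma multiDegree_flatMap {α : Type} (l : List α) (f : α → List (Arc V)) (c : Color) (v : V) :
    multiDegree (l.flatMap f : Multiset (Arc V)) c v =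
      (l.map fun a => multiDegree (f a : Multiset (Arc V)) c v).sum := by
  induction l with
  | nil => rfl
  | cons a l ih =>
    rw [List.flatMap_cons, ← Multiset.coe_add, multiDegree_add, ih, List.map_cons, List.sum_cons]

lemma multiDegree_filter {M : Multiset (Arc V)} {p : Arc V → Prop} [DecidablePred p] {v : V}
    (h : ∀ a ∈ M, a.2.1 = v ∨ a.2.2 = v → p a) (c : Color) :
    multiDegree (M.filter p) c v = multiDegree M c v := by
  rw [multiDegree, multiDegree, Multiset.filter_filter, Multiset.filter_filter]
  congr 2 <;> refine Multiset.filter_congr fun a ha => ?_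
  · exact and_iff_left_of_imp fun h' => h a ha (.inl h'.2)
  · exact and_iff_left_of_imp fun h' => h a ha (.inr h'.2)

lemma multiDegree_eq_zero {M : Multiset (Arc V)} {v : V} (h : ∀ a ∈ M, a.2.1 ≠ v ∧ a.2.2 ≠ v)
    (c : Color) : multiDegree M c v = 0 := by
  rw [multiDegree, Multiset.filter_eq_nil.2 fun a ha h' => (h a ha).1 h'.2,
    Multiset.filter_eq_nil.2 fun a ha h' => (h a ha).2 h'.2]
  rfl

lemma multiDegree_pos {M : Multiset (Arc V)} {v : V} {a : Arc V} (ha : a ∈ M)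
    (h : a.2.1 = v ∨ a.2.2 = v) : 0 < multiDegree M .red v + multiDegree M .blue v := by
  obtain ⟨K, rfl⟩ := Multiset.exists_cons_of_mem ha
  rw [multiDegree_cons, multiDegree_cons]
  cases hc : a.1 <;> rcases h with h | h <;> simp [h]

lemma multiDegree_red_eq_zero {M : Multiset (Arc V)} (h : ∀ a ∈ M, a.1 = .blue) (v : V) :
    multiDegree M .red v = 0 := by
  rw [multiDegree, Multiset.filter_eq_nil.2 fun a ha h' => by simp [h a ha] at h',
    Multiset.filter_eq_nil.2 fun a ha h' => by simp [h a ha] at h']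
  rfl

lemma sum_multiDegree {U : Finset V} {M : Multiset (Arc V)} (h : Within (U : Set V) M) (c : Color) :
    ∑ v ∈ U, multiDegree M c v = 2 * (M.filter fun a => a.1 = c).card := by
  induction M using Multiset.induction with
  | empty => simp [multiDegree_zero]
  | cons a M ih =>
    obtain ⟨h1, h2⟩ := h a (by simp)
    simp only [Finset.mem_coe] at h1 h2
    simp only [multiDegree_cons, Finset.sum_add_distrib, ih fun b hb => h b (by simp [hb])]
    by_cases hc : a.1 = c
    · simp [hc, h1, h2]
      omega
    · simp [hc]

lemma multiDegree_map {W : Type} [DecidableEq W] {U : Set V} {f : V → W} (hf : Set.InjOn f U)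
    {M : Multiset (Arc V)} (hM : Within U M) {v : V} (hv : v ∈ U) (c : Color) :
    multiDegree (M.map (mapArc f)) c (f v) = multiDegree M c v := by
  rw [multiDegree, multiDegree, Multiset.filter_map, Multiset.filter_map, Multiset.card_map,
    Multiset.card_map]
  congr 2 <;> refine Multiset.filter_congr fun a ha => ?_
  · simp only [Function.comp, mapArc, hf.eq_iff (hM a ha).1 hv]
  · simp only [Function.comp, mapArc, hf.eq_iff (hM a ha).2 hv]

lemma inWeight_filter {M : Multiset (Arc V)} {p : Arc V → Prop} [DecidablePred p] {v : V}
    (h : ∀ a ∈ M, a.2.2 = v → p a) : inWeight (M.filter p) v = inWeight M v := by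
  induction M using Multiset.induction with
  | empty => rfl
  | cons a M ih =>
    have ih := ih fun b hb => h b (by simp [hb])
    by_cases hp : p a
    · rw [Multiset.filter_cons_of_pos _ hp, inWeight_cons, inWeight_cons, ih]
    · rw [Multiset.filter_cons_of_neg _ hp, inWeight_cons, ih,
        if_neg fun h' => hp (h a (by simp) h'), zero_add]

/-- The set `{v}` is closed under the arcs, so it is a whole component: one vertex and no arc. -/
lemma Components.deficient_of_isolated {L : Type} [DecidableEq L] {U : Finset V} {lab : V → L}
    {M : Multiset (Arc V)} (hM : Components U lab M) {v : V} (hv : v ∈ U)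
    (h : ∀ a ∈ M, a.2.1 ≠ v ∧ a.2.2 ≠ v) : Deficient U lab M (lab v) := by
  have hU : U.filter (fun u => lab u = lab v) = {v} := by
    ext u
    rw [Finset.mem_filter, Finset.mem_singleton]
    constructor
    · rintro ⟨hu, huv⟩
      exact hM.connected {v} (fun a ha => by simp [h a ha]) v hv u hu huv.symm rfl
    · rintro rfl
      exact ⟨hv, rfl⟩
  rw [Deficient, hM.labelArcs_eq, hU, Finset.sum_singleton, Finset.card_singleton, inDeg,
    Multiset.filter_eq_nil.2 fun a ha => (h a ha).2]
  exact zero_lt_one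

end

/-! ### The replacement that preserves AND/OR graphs -/

namespace C2EInstance

variable (I : C2EInstance)

/-- The arcs of the deficient blue components and the pendant arcs. -/
def pendants : List (Arc ℕ) := pendantReplace I.n I.specialArcs I.ordinaryArcs

/-- The number of ends of ordinary arcs at a vertex. -/
def ordDegree (v : ℕ) : ℕ := multiDegree (I.ordinaryArcs : Multiset (Arc ℕ)) .blue v

open Classical in
/-- The labels of the components after the replacement. -/
noncomputable def pendantLab (v : ℕ) : ℕ ⊕ ℕ :=
  if v < I.n ∧ I.IsDef (I.lab v) then .inl (I.lab v) else .inr (if v < I.n then v else v - I.n)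

lemma length_filter_endsOf {l : List (Arc ℕ)} (h : ∀ a ∈ l, a.1 = .blue) (t : ℕ) :
    ((endsOf l).filter fun v => decide (v = t)).length =
      multiDegree (l : Multiset (Arc ℕ)) .blue t := by
  induction l with
  | nil => rfl
  | cons a l ih =>
    rw [← Multiset.cons_coe, multiDegree_cons, ← ih fun b hb => h b (by simp [hb]), h a (by simp)]
    simp only [endsOf, List.flatMap_cons, List.filter_append, List.length_append, true_and]
    by_cases h1 : a.2.1 = t <;> by_cases h2 : a.2.2 = t <;> simp [h1, h2]

open Classical in
lemma pendantArcs_eq (t : ℕ) : pendantArcs I.n I.ordinaryArcs (labels I.n I.ordinaryArcs) t =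
    if I.IsDef (I.lab t) then [] else if I.ordDegree t = 1 then
      [(.blue, I.n + t, t), (.blue, I.n + t, I.n + t)] else [(.blue, t, t)] := by
  have hd : isDeficient (labels I.n I.ordinaryArcs) I.ordinaryArcs
      (labelOf (labels I.n I.ordinaryArcs) t) = true ↔ I.IsDef (I.lab t) := I.isDeficient_iff_isDef
  rw [pendantArcs, length_filter_endsOf I.blue_of_mem]
  by_cases h : I.IsDef (I.lab t)
  · simp [hd.2 h, h]
  · by_cases h1 : I.ordDegree t = 1
    · simp [Bool.eq_false_iff.2 (mt hd.1 h), h, h1, show multiDegree _ _ _ = 1 from h1]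
    · simp [Bool.eq_false_iff.2 (mt hd.1 h), h, h1, show ¬multiDegree _ _ _ = 1 from h1]

lemma mem_pendantArcs {t : ℕ} {a : Arc ℕ} :
    a ∈ pendantArcs I.n I.ordinaryArcs (labels I.n I.ordinaryArcs) t ↔ ¬I.IsDef (I.lab t) ∧
      (I.ordDegree t = 1 ∧ (a = (.blue, I.n + t, t) ∨ a = (.blue, I.n + t, I.n + t)) ∨
        I.ordDegree t ≠ 1 ∧ a = (.blue, t, t)) := by
  rw [pendantArcs_eq]
  by_cases h : I.IsDef (I.lab t) <;> by_cases h1 : I.ordDegree t = 1 <;> simp [h, h1]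

open Classical in
lemma coe_pendants : (I.pendants : Multiset (Arc ℕ)) =
    (I.ordinaryArcs : Multiset (Arc ℕ)).filter (fun a => I.IsDef (I.lab a.2.2)) +
      ((endsOf I.specialArcs).dedup.flatMap
        (pendantArcs I.n I.ordinaryArcs (labels I.n I.ordinaryArcs)) : List (Arc ℕ)) := by
  rw [pendants, pendantReplace, ← Multiset.coe_add, Multiset.filter_coe]
  congr 2
  refine List.filter_congr fun a _ => ?_
  rw [Bool.eq_iff_iff, decide_eq_true_iff]
  exact I.isDeficient_iff_isDef

open Classical in
lemma mem_pendants {a : Arc ℕ} : a ∈ I.pendants ↔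
    (a ∈ I.ordinaryArcs ∧ I.IsDef (I.lab a.2.2)) ∨ ∃ t ∈ endsOf I.specialArcs,
      a ∈ pendantArcs I.n I.ordinaryArcs (labels I.n I.ordinaryArcs) t := by
  rw [← Multiset.mem_coe, coe_pendants, Multiset.mem_add, Multiset.mem_filter, Multiset.mem_coe,
    Multiset.mem_coe, List.mem_flatMap]
  simp only [List.mem_dedup]

lemma lt_of_mem_ordinaryArcs {a : Arc ℕ} (ha : a ∈ I.ordinaryArcs) : a.2.1 < I.n ∧ a.2.2 < I.n :=
  I.within a (I.mem_arcList.2 (.inr ha))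

lemma mem_ends_pendants {v : ℕ} : v ∈ endsOf (I.specialArcs ++ I.pendants) ↔
    v ∈ endsOf I.specialArcs ∨ (v < I.n ∧ I.IsDef (I.lab v)) ∨
      ∃ t ∈ endsOf I.specialArcs, ¬I.IsDef (I.lab t) ∧ I.ordDegree t = 1 ∧ v = I.n + t := by
  rw [endsOf_append, List.mem_append, mem_endsOf (l := I.pendants)]
  constructor
  · rintro (h | ⟨a, ha, h⟩)
    · exact .inl h
    · rcases I.mem_pendants.1 ha with ⟨ha, hd⟩ | ⟨t, ht, ha⟩
      · refine .inr (.inl ?_)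
        rcases h with rfl | rfl
        · exact ⟨(I.lt_of_mem_ordinaryArcs ha).1, (I.components_lab.label a ha) ▸ hd⟩
        · exact ⟨(I.lt_of_mem_ordinaryArcs ha).2, hd⟩
      · obtain ⟨hd, ⟨h1, rfl | rfl⟩ | ⟨-, rfl⟩⟩ := I.mem_pendantArcs.1 ha <;>
          rcases h with rfl | rfl <;>
          first | exact .inl ht | exact .inr (.inr ⟨t, ht, hd, h1, rfl⟩)
  · rintro (h | ⟨hv, hd⟩ | ⟨t, ht, hd, h1, rfl⟩)
    · exact .inl h
    -- No vertex of a deficient component gets lost: some arc enters it, which is special or an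
    -- ordinary arc that is kept.
    · obtain ⟨a, ha, rfl⟩ := inWeight_pos_of_mem (zero_lt_two.trans_le (I.two_le_inWeight hv))
      rcases Multiset.mem_add.1 ha with ha | ha
      · exact .inl (mem_endsOf.2 ⟨a, ha, .inr rfl⟩)
      · exact .inr ⟨a, I.mem_pendants.2 (.inl ⟨ha, hd⟩), .inr rfl⟩
    · exact .inr ⟨_, I.mem_pendants.2 (.inr ⟨t, ht, I.mem_pendantArcs.2
        ⟨hd, .inl ⟨h1, .inl rfl⟩⟩⟩), .inl rfl⟩

lemma pendantLab_of_isDef {v : ℕ} (hv : v < I.n) (hd : I.IsDef (I.lab v)) :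
    I.pendantLab v = .inl (I.lab v) := by
  simp [pendantLab, hv, hd]

lemma pendantLab_of_not {v : ℕ} (hv : v < I.n) (hd : ¬I.IsDef (I.lab v)) :
    I.pendantLab v = .inr v := by
  simp [pendantLab, hv, hd]

lemma pendantLab_add (v : ℕ) : I.pendantLab (I.n + v) = .inr v := by
  simp [pendantLab]

lemma pendantLab_eq_inl {v l : ℕ} : I.pendantLab v = .inl l ↔ v < I.n ∧ I.IsDef l ∧ I.lab v = l := by
  rw [pendantLab]
  split_ifs with h
  · rw [Sum.inl.injEq]
    constructor
    · rintro rfl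
      exact ⟨h.1, h.2, rfl⟩
    · exact fun h' => h'.2.2
  · simp only [false_iff]
    rintro ⟨h1, h2, rfl⟩
    exact h ⟨h1, h2⟩

lemma eq_or_eq_of_pendantLab_eq_inr {v x : ℕ} (hv : v ∈ endsOf (I.specialArcs ++ I.pendants))
    (h : I.pendantLab v = .inr x) : x ∈ endsOf I.specialArcs ∧ ¬I.IsDef (I.lab x) ∧
      (v = x ∨ v = I.n + x ∧ I.ordDegree x = 1) := by
  rcases I.mem_ends_pendants.1 hv with ht | ⟨h1, h2⟩ | ⟨t, ht, hd, h1, rfl⟩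
  · have hlt := I.lt_of_mem_endsOf ht
    by_cases hd : I.IsDef (I.lab v)
    · rw [I.pendantLab_of_isDef hlt hd] at h
      simp at h
    · rw [I.pendantLab_of_not hlt hd, Sum.inr.injEq] at h
      exact ⟨h ▸ ht, h ▸ hd, .inl h⟩
  · rw [I.pendantLab_of_isDef h1 h2] at h
    simp at h
  · rw [pendantLab_add, Sum.inr.injEq] at h
    subst h
    exact ⟨ht, hd, .inr ⟨rfl, h1⟩⟩

lemma components_pendants : Components (endsOf (I.specialArcs ++ I.pendants)).toFinset
    I.pendantLab (I.pendants : Multiset (Arc ℕ)) := by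
  refine ⟨?_, ?_, ?_, ?_⟩
  · intro a ha
    rcases I.mem_pendants.1 ha with ⟨ha, -⟩ | ⟨t, -, ha⟩
    · exact I.blue_of_mem a ha
    · obtain ⟨hd, ⟨h1, rfl | rfl⟩ | ⟨-, rfl⟩⟩ := I.mem_pendantArcs.1 ha <;> rfl
  · exact fun a ha => within_endsOf (I.specialArcs ++ I.pendants) a
      (List.mem_append_right _ ha)
  · intro a ha
    rcases I.mem_pendants.1 ha with ⟨ha, hd⟩ | ⟨t, ht, ha⟩
    · have hl := I.components_lab.label a ha
      obtain ⟨h1, h2⟩ := I.lt_of_mem_ordinaryArcs ha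
      rw [I.pendantLab_of_isDef h2 hd, I.pendantLab_of_isDef h1 (hl ▸ hd), hl]
    · have hlt := I.lt_of_mem_endsOf ht
      obtain ⟨hd, ⟨h1, rfl | rfl⟩ | ⟨-, rfl⟩⟩ := I.mem_pendantArcs.1 ha
      · exact (I.pendantLab_add t).trans (I.pendantLab_of_not hlt hd).symm
      · rfl
      · rfl
  · intro F hF u hu v hv huv h
    rw [List.mem_toFinset] at hu hv
    cases hl : I.pendantLab u with
    | inl l =>
      obtain ⟨hu1, hd, hul⟩ := I.pendantLab_eq_inl.1 hl
      obtain ⟨hv1, -, hvl⟩ := I.pendantLab_eq_inl.1 (huv ▸ hl)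
      -- `F` is closed only under the kept arcs. Adding all vertices outside the deficient
      -- components makes it closed under all ordinary arcs.
      have := I.components_lab.connected (F ∪ {w | ¬I.IsDef (I.lab w)}) (fun a ha => by
        have hlab := I.components_lab.label a ha
        by_cases hda : I.IsDef (I.lab a.2.2)
        · have := hF a (I.mem_pendants.2 (.inl ⟨ha, hda⟩))
          simp [this, hlab, hda]
        · simp [hlab, hda]) u (by simpa using hu1) v (by simpa using hv1) (hul.trans hvl.symm) (.inl h)
      rcases this with h' | h'
      · exact h'
      · exact absurd (hvl ▸ hd) h'
    | inr x =>
      obtain ⟨hx, hd, hux⟩ := I.eq_or_eq_of_pendantLab_eq_inr hu hl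
      obtain ⟨-, -, hvx⟩ := I.eq_or_eq_of_pendantLab_eq_inr hv (huv ▸ hl)
      have key : I.ordDegree x = 1 → (I.n + x ∈ F ↔ x ∈ F) := fun h1 =>
        hF _ (I.mem_pendants.2 (.inr ⟨x, hx, I.mem_pendantArcs.2 ⟨hd, .inl ⟨h1, .inl rfl⟩⟩⟩))
      rcases hux with rfl | ⟨rfl, h1⟩ <;> rcases hvx with rfl | ⟨rfl, h2⟩
      · exact h
      · exact (key h2).2 h
      · exact (key h1).1 h
      · exact h

lemma feasOn_pendants : FeasOn (endsOf (I.specialArcs ++ I.pendants)).toFinset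
    ((I.specialArcs : Multiset (Arc ℕ)) + (I.pendants : Multiset (Arc ℕ))) := by
  classical
  have hblue : ∀ a ∈ I.pendants, 2 ≤ inWeight ((I.specialArcs : Multiset (Arc ℕ)) +
      (I.pendants : Multiset (Arc ℕ))) a.2.2 := fun a ha =>
    two_le_inWeight_of_blue (Multiset.mem_add.2 (.inr ha)) (I.components_pendants.blue a ha)
  have hdef : ∀ v < I.n, I.IsDef (I.lab v) → 2 ≤ inWeight ((I.specialArcs : Multiset (Arc ℕ)) +
      (I.pendants : Multiset (Arc ℕ))) v := by
    intro v hv hd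
    refine (I.two_le_inWeight hv).trans ?_
    rw [coe_pendants, inWeight_add, inWeight_add, inWeight_add,
      inWeight_filter fun a _ h => h ▸ hd]
    omega
  intro v hv
  rw [List.mem_toFinset, mem_ends_pendants] at hv
  rcases hv with hv | ⟨hv, hd⟩ | ⟨t, ht, hd, h1, rfl⟩
  · by_cases hd : I.IsDef (I.lab v)
    · exact hdef v (I.lt_of_mem_endsOf hv) hd
    · by_cases h1 : I.ordDegree v = 1
      · exact hblue _ (I.mem_pendants.2 (.inr ⟨v, hv, I.mem_pendantArcs.2
          ⟨hd, .inl ⟨h1, .inl rfl⟩⟩⟩))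
      · exact hblue _ (I.mem_pendants.2 (.inr ⟨v, hv, I.mem_pendantArcs.2 ⟨hd, .inr ⟨h1, rfl⟩⟩⟩))
  · exact hdef v hv hd
  · exact hblue _ (I.mem_pendants.2 (.inr ⟨t, ht, I.mem_pendantArcs.2
      ⟨hd, .inl ⟨h1, .inr rfl⟩⟩⟩))

lemma deficient_pendants_inl {l : ℕ} : Deficient (endsOf (I.specialArcs ++ I.pendants)).toFinset
    I.pendantLab (I.pendants : Multiset (Arc ℕ)) (.inl l) ↔ I.IsDef l := by
  classical
  by_cases hl : I.IsDef l
  · have hU : (endsOf (I.specialArcs ++ I.pendants)).toFinset.filter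
        (fun v => I.pendantLab v = .inl l) = (Finset.range I.n).filter (fun v => I.lab v = l) := by
      ext v
      rw [Finset.mem_filter, Finset.mem_filter, List.mem_toFinset, mem_ends_pendants,
        pendantLab_eq_inl, Finset.mem_range]
      constructor
      · exact fun h => ⟨h.2.1, h.2.2.2⟩
      · rintro ⟨h1, h2⟩
        exact ⟨.inr (.inl ⟨h1, h2 ▸ hl⟩), h1, hl, h2⟩
    rw [Deficient, IsDef, Deficient, hU, labelArcs, labelArcs, coe_pendants, Multiset.filter_add,
      Multiset.filter_eq_nil (s := ((List.flatMap _ _ : List (Arc ℕ)) : Multiset (Arc ℕ))) |>.2,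
      add_zero, Multiset.filter_filter]
    · refine iff_of_eq (congrArg₂ _ (congrArg _ (Multiset.filter_congr fun a ha => ?_)) rfl)
      have hlt := (I.lt_of_mem_ordinaryArcs ha).2
      rw [pendantLab_eq_inl]
      constructor
      · exact fun h => h.1.2.2
      · rintro rfl
        exact ⟨⟨hlt, hl, rfl⟩, hl⟩
    · intro a ha h
      rw [Multiset.mem_coe, List.mem_flatMap] at ha
      obtain ⟨t, ht, ha⟩ := ha
      obtain ⟨h1, -, h2⟩ := I.pendantLab_eq_inl.1 h
      obtain ⟨hd, ⟨-, rfl | rfl⟩ | ⟨-, rfl⟩⟩ := I.mem_pendantArcs.1 ha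
      · exact hd (h2 ▸ hl)
      · dsimp only at h1
        omega
      · exact hd (h2 ▸ hl)
  · refine iff_of_false (fun h => ?_) hl
    obtain ⟨v, -, hv, -⟩ := I.components_pendants.exists_inDeg_eq_zero h
    exact hl (I.pendantLab_eq_inl.1 hv).2.1

/-- Each vertex of a new component, the terminal as well as the added vertex, is entered by a new
arc, so no vertex witnesses a deficiency. -/
lemma not_deficient_pendants_inr {x : ℕ} :
    ¬Deficient (endsOf (I.specialArcs ++ I.pendants)).toFinset I.pendantLab
      (I.pendants : Multiset (Arc ℕ)) (.inr x) := by
  intro h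
  obtain ⟨v, hv, hvx, h0⟩ := I.components_pendants.exists_inDeg_eq_zero h
  rw [List.mem_toFinset] at hv
  obtain ⟨hx, hd, hvx⟩ := I.eq_or_eq_of_pendantLab_eq_inr hv hvx
  have : ∃ a ∈ I.pendants, a.2.2 = v := by
    rcases hvx with rfl | ⟨rfl, h1⟩
    · by_cases h1 : I.ordDegree v = 1
      · exact ⟨_, I.mem_pendants.2 (.inr ⟨v, hx, I.mem_pendantArcs.2 ⟨hd, .inl ⟨h1, .inl rfl⟩⟩⟩), rfl⟩
      · exact ⟨_, I.mem_pendants.2 (.inr ⟨v, hx, I.mem_pendantArcs.2 ⟨hd, .inr ⟨h1, rfl⟩⟩⟩), rfl⟩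
    · exact ⟨_, I.mem_pendants.2 (.inr ⟨x, hx, I.mem_pendantArcs.2 ⟨hd, .inl ⟨h1, .inr rfl⟩⟩⟩), rfl⟩
  obtain ⟨a, ha, rfl⟩ := this
  have := inDeg_pos (M := (I.pendants : Multiset (Arc ℕ))) ha
  omega

lemma hits_pendants (X : Set ℕ) (hX : X ⊆ {t | t ∈ endsOf I.specialArcs}) :
    Hits (Finset.range I.n) I.lab I.IsDef X ↔
      Hits (endsOf (I.specialArcs ++ I.pendants)).toFinset I.pendantLab
        (Deficient (endsOf (I.specialArcs ++ I.pendants)).toFinset I.pendantLab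
          (I.pendants : Multiset (Arc ℕ))) X := by
  simp only [Hits, Sum.forall, not_deficient_pendants_inr, false_imp_iff, forall_const, and_true,
    deficient_pendants_inl]
  refine forall_congr' fun l => imp_congr_right fun hl => exists_congr fun t => ?_
  constructor
  · rintro ⟨-, h, ht⟩
    exact ⟨by rw [List.mem_toFinset, mem_ends_pendants]; exact .inl (hX ht),
      I.pendantLab_eq_inl.2 ⟨I.lt_of_mem_endsOf (hX ht), hl, h⟩, ht⟩
  · rintro ⟨-, h, ht⟩
    exact ⟨Finset.mem_range.2 (I.lt_of_mem_endsOf (hX ht)), (I.pendantLab_eq_inl.1 h).2.2, ht⟩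

end C2EInstance

namespace C2EInstance

variable (I : C2EInstance)

/-! ### Degrees -/

lemma multiDegree_arcList (c : Color) (v : ℕ) :
    multiDegree (I.arcList : Multiset (Arc ℕ)) c v =
      multiDegree (I.specialArcs : Multiset (Arc ℕ)) c v +
        multiDegree (I.ordinaryArcs : Multiset (Arc ℕ)) c v := by
  rw [I.coe_arcList, multiDegree_add]

lemma multiDegree_flatMap_pendantArcs_of_ne {v : ℕ}
    (h : ∀ t ∈ endsOf I.specialArcs, ¬I.IsDef (I.lab t) → t ≠ v ∧ I.n + t ≠ v) (c : Color) :
    multiDegree ((endsOf I.specialArcs).dedup.flatMap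
      (pendantArcs I.n I.ordinaryArcs (labels I.n I.ordinaryArcs)) : List (Arc ℕ)) c v = 0 := by
  refine multiDegree_eq_zero (fun a ha => ?_) c
  rw [Multiset.mem_coe, List.mem_flatMap] at ha
  obtain ⟨t, ht, ha⟩ := ha
  obtain ⟨hd, ha⟩ := I.mem_pendantArcs.1 ha
  obtain ⟨h1, h2⟩ := h t (List.mem_dedup.1 ht) hd
  obtain ⟨-, rfl | rfl⟩ | ⟨-, rfl⟩ := ha
  · exact ⟨h2, h1⟩
  · exact ⟨h2, h2⟩
  · exact ⟨h1, h1⟩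

lemma multiDegree_flatMap_pendantArcs {t v : ℕ} (ht : t ∈ endsOf I.specialArcs)
    (h : ∀ u ∈ endsOf I.specialArcs, u ≠ t → u ≠ v ∧ I.n + u ≠ v) (c : Color) :
    multiDegree ((endsOf I.specialArcs).dedup.flatMap
      (pendantArcs I.n I.ordinaryArcs (labels I.n I.ordinaryArcs)) : List (Arc ℕ)) c v =
    multiDegree (pendantArcs I.n I.ordinaryArcs (labels I.n I.ordinaryArcs) t :
      Multiset (Arc ℕ)) c v := by
  rw [multiDegree_flatMap, List.sum_map_eq_nsmul_single t, List.count_eq_one_of_mem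
    (List.nodup_dedup _) (List.mem_dedup.2 ht), one_smul]
  intro u hut hu
  refine multiDegree_eq_zero (fun a ha => ?_) c
  obtain ⟨-, ha⟩ := I.mem_pendantArcs.1 ha
  obtain ⟨h1, h2⟩ := h u (List.mem_dedup.1 hu) hut
  obtain ⟨-, rfl | rfl⟩ | ⟨-, rfl⟩ := ha
  · exact ⟨h2, h1⟩
  · exact ⟨h2, h2⟩
  · exact ⟨h1, h1⟩

/-- An isolated vertex would be a deficient component. With `ordDegree_le_two`, this leaves the
degrees one and two, the two cases of `pendantArcs`. -/
lemma ordDegree_pos {v : ℕ} (hv : v < I.n) (hd : ¬I.IsDef (I.lab v)) : 0 < I.ordDegree v := by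
  rw [Nat.pos_iff_ne_zero]
  intro h0
  refine hd (I.components_lab.deficient_of_isolated (Finset.mem_range.2 hv) fun a ha => ?_)
  by_contra hc
  have := multiDegree_pos (v := v) ha (by tauto)
  rw [multiDegree_red_eq_zero I.blue_of_mem] at this
  rw [ordDegree] at h0
  omega

variable {I}

lemma degree_of_isAndOr (h : I.G.IsAndOr) {v : ℕ} (hv : v < I.n) :
    (multiDegree (I.arcList : Multiset (Arc ℕ)) .blue v = 1 ∧
      multiDegree (I.arcList : Multiset (Arc ℕ)) .red v = 2) ∨
    (multiDegree (I.arcList : Multiset (Arc ℕ)) .blue v = 3 ∧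
      multiDegree (I.arcList : Multiset (Arc ℕ)) .red v = 0) := by
  have := h ⟨v, hv⟩
  simpa only [ConstraintGraph.IsAnd, ConstraintGraph.IsOr, degree_eq] using this

/-- The total degree is three, and a special edge takes at least one end at a terminal. -/
lemma ordDegree_le_two (h : I.G.IsAndOr) {t : ℕ} (ht : t ∈ endsOf I.specialArcs) :
    I.ordDegree t ≤ 2 := by
  obtain ⟨a, ha, hat⟩ := mem_endsOf.1 ht
  have h1 := multiDegree_pos (M := (I.specialArcs : Multiset (Arc ℕ))) ha (v := t)
    (hat.imp Eq.symm Eq.symm)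
  have h2 := degree_of_isAndOr h (I.lt_of_mem_endsOf ht)
  rw [I.multiDegree_arcList, I.multiDegree_arcList] at h2
  rw [ordDegree]
  omega

/-- Vertices of deficient components keep all their ordinary arcs. At any other surviving vertex,
which is a terminal, the lost ordinary ends are made up for by one pendant edge or by a loop, which
counts twice. -/
lemma multiDegree_pendants_of_lt (h : I.G.IsAndOr) {v : ℕ} (hv : v < I.n)
    (hve : v ∈ endsOf (I.specialArcs ++ I.pendants)) (c : Color) :
    multiDegree ((I.specialArcs ++ I.pendants : List (Arc ℕ)) : Multiset (Arc ℕ)) c v =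
      multiDegree (I.arcList : Multiset (Arc ℕ)) c v := by
  classical
  rw [← Multiset.coe_add, multiDegree_add, I.multiDegree_arcList, coe_pendants, multiDegree_add]
  congr 1
  by_cases hd : I.IsDef (I.lab v)
  · rw [I.multiDegree_flatMap_pendantArcs_of_ne fun t ht hdt =>
      ⟨fun h => hdt (h ▸ hd), by omega⟩, add_zero]
    refine multiDegree_filter (fun a ha h => ?_) c
    rcases h with rfl | rfl
    · exact (I.components_lab.label a ha) ▸ hd
    · exact hd
  · have hvT : v ∈ endsOf I.specialArcs := by
      rcases I.mem_ends_pendants.1 hve with h | h | ⟨t, -, -, -, rfl⟩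
      · exact h
      · exact absurd h.2 hd
      · omega
    rw [multiDegree_eq_zero (fun a ha => ?_), zero_add,
      I.multiDegree_flatMap_pendantArcs hvT fun u _ hu => ⟨hu, by omega⟩, pendantArcs_eq,
      if_neg hd]
    · cases c with
      | red =>
        rw [multiDegree_red_eq_zero (M := (I.ordinaryArcs : Multiset (Arc ℕ))) I.blue_of_mem]
        refine multiDegree_red_eq_zero (fun a ha => ?_) v
        split_ifs at ha <;> simp only [Multiset.mem_coe, List.mem_cons, List.not_mem_nil,
          or_false] at ha
        · rcases ha with rfl | rfl <;> rfl
        · rw [ha]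
      | blue =>
        change _ = I.ordDegree v
        have h1 := I.ordDegree_pos hv hd
        have h2 := ordDegree_le_two h hvT
        have h3 : I.n ≠ 0 := by omega
        split_ifs with h4
        · rw [h4, ← Multiset.cons_coe, ← Multiset.cons_coe, multiDegree_cons, multiDegree_cons]
          simp [h3, multiDegree_zero]
        · rw [← Multiset.cons_coe, multiDegree_cons]
          simp only [and_self, if_true, Multiset.coe_nil, multiDegree_zero]
          omega
    · rw [Multiset.mem_filter] at ha
      constructor
      · rintro rfl
        exact hd ((I.components_lab.label a ha.1) ▸ ha.2)
      · rintro rfl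
        exact hd ha.2

/-- The added vertex has a blue edge to `t` and a blue loop, so it is an OR vertex. -/
lemma multiDegree_pendants_add {t : ℕ} (ht : t ∈ endsOf I.specialArcs) (hd : ¬I.IsDef (I.lab t))
    (h1 : I.ordDegree t = 1) (c : Color) :
    multiDegree ((I.specialArcs ++ I.pendants : List (Arc ℕ)) : Multiset (Arc ℕ)) c (I.n + t) =
      if c = .blue then 3 else 0 := by
  classical
  have hlt := I.lt_of_mem_endsOf ht
  rw [← Multiset.coe_add, multiDegree_add, coe_pendants, multiDegree_add, multiDegree_eq_zero,
    multiDegree_eq_zero, I.multiDegree_flatMap_pendantArcs ht, pendantArcs_eq, if_neg hd, if_pos h1,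
    ← Multiset.cons_coe, ← Multiset.cons_coe, multiDegree_cons, multiDegree_cons]
  · have : I.n ≠ 0 := by omega
    cases c <;> simp [this, multiDegree_zero]
  · intro u hu hut
    have := I.lt_of_mem_endsOf hu
    omega
  · intro a ha
    have := I.lt_of_mem_ordinaryArcs (Multiset.mem_of_mem_filter ha)
    omega
  · intro a ha
    have := I.within a (I.mem_arcList.2 (.inl ha))
    omega

lemma isAndOr_of_pendants (h : I.G.IsAndOr) {J : C2EInstance}
    (hn : J.n = (endsOf (I.specialArcs ++ I.pendants)).dedup.length)
    (hJ : J.arcList = (I.specialArcs ++ I.pendants).map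
      (mapArc (endsOf (I.specialArcs ++ I.pendants)).dedup.idxOf)) : J.G.IsAndOr := by
  intro w
  set K := endsOf (I.specialArcs ++ I.pendants) with hK
  have hw : (w : ℕ) ∈ Finset.range K.dedup.length := by
    rw [Finset.mem_range, ← hn]
    exact w.2
  rw [← image_idxOf_dedup, Finset.mem_image] at hw
  obtain ⟨v, hv, hvw⟩ := hw
  have hinj : Set.InjOn K.dedup.idxOf (K.toFinset : Set ℕ) := by
    have := idxOf_injOn K.dedup
    rwa [show K.dedup.toFinset = K.toFinset by ext; simp] at this
  have hdeg : ∀ c, J.G.degree c w =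
      multiDegree ((I.specialArcs ++ I.pendants : List (Arc ℕ)) : Multiset (Arc ℕ)) c v := by
    intro c
    rw [degree_eq, hJ, ← Multiset.map_coe, ← hvw]
    exact multiDegree_map hinj (within_endsOf _) hv c
  simp only [ConstraintGraph.IsAnd, ConstraintGraph.IsOr, hdeg]
  rw [List.mem_toFinset] at hv
  by_cases hlt : v < I.n
  · simp only [multiDegree_pendants_of_lt h hlt hv]
    exact degree_of_isAndOr h hlt
  · rcases I.mem_ends_pendants.1 hv with ht | ht | ⟨t, ht, hd, h1, rfl⟩
    · exact absurd (I.lt_of_mem_endsOf ht) hlt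
    · exact absurd ht.1 hlt
    · right
      simp [multiDegree_pendants_add ht hd h1]

/-! ### Sizes -/

/-- Handshake: the red degrees sum up to twice the number of red edges, and they are two at AND
vertices and zero at OR vertices. -/
lemma numRed_le_numAnd (h : I.G.IsAndOr) : I.G.numRed ≤ I.G.numAnd := by
  classical
  have h1 := sum_multiDegree (U := Finset.range I.n) (M := (I.arcList : Multiset (Arc ℕ)))
    (fun a ha => by simpa using I.within a ha) .red
  have h2 : ((I.arcList : Multiset (Arc ℕ)).filter fun a => a.1 = .red).card = I.G.numRed := by
    rw [numRed_eq, Multiset.filter_coe, Multiset.coe_card]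
  have h3 : I.G.numAnd = ∑ v : Fin I.n, if I.G.IsAnd v then 1 else 0 := by
    rw [ConstraintGraph.numAnd, ← Finset.card_filter, ← Set.ncard_coe_finset]
    simp
  have h4 : ∑ v : Fin I.n, multiDegree (I.arcList : Multiset (Arc ℕ)) .red v ≤
      ∑ v : Fin I.n, 2 * if I.G.IsAnd v then 1 else 0 := by
    refine Finset.sum_le_sum fun v _ => ?_
    rw [← degree_eq]
    rcases h v with hv | hv
    · simp [hv, hv.2]
    · simp [hv.2]
  rw [← Finset.mul_sum, ← h3, ← Finset.sum_range fun v =>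
    multiDegree (I.arcList : Multiset (Arc ℕ)) .red v, h1, h2] at h4
  omega

open Classical in
-- Let `M` be the kept arcs, `W` the vertices of deficient components and `T` the terminals.
-- Deficiency gives `|M| ≤ |W|`. Vertices of `W` outside `T` have degree three in `M`, so `3 * (|W|
-- - |T|) ≤ 2 * |M|`. Together, `|M| ≤ 3 * |T|`.
lemma card_filter_isDef_le (h : I.G.IsAndOr) :
    ((I.ordinaryArcs : Multiset (Arc ℕ)).filter fun a => I.IsDef (I.lab a.2.2)).card ≤
      3 * (endsOf I.specialArcs).dedup.length := by
  set M := (I.ordinaryArcs : Multiset (Arc ℕ)).filter fun a => I.IsDef (I.lab a.2.2) with hM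
  set W := (Finset.range I.n).filter fun v => I.IsDef (I.lab v) with hW
  have hMW : M.card ≤ W.card := by
    have h1 : M = (I.ordinaryArcs : Multiset (Arc ℕ)).filter fun a => a.2.2 ∈ W := by
      refine Multiset.filter_congr fun a ha => ?_
      rw [hW, Finset.mem_filter, Finset.mem_range]
      exact (and_iff_right (I.lt_of_mem_ordinaryArcs ha).2).symm
    -- Both sides are split by component, where deficiency compares them.
    rw [h1, card_filter_mem_eq_sum, Finset.card_eq_sum_ones,
      ← Finset.sum_fiberwise_of_maps_to (g := I.lab) (t := W.image I.lab)
        (fun v hv => Finset.mem_image_of_mem _ hv),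
      ← Finset.sum_fiberwise_of_maps_to (s := W) (g := I.lab) (t := W.image I.lab)
        (fun v hv => Finset.mem_image_of_mem _ hv)]
    refine Finset.sum_le_sum fun l hl => ?_
    obtain ⟨v, hv, rfl⟩ := Finset.mem_image.1 hl
    have hd : I.IsDef (I.lab v) := (Finset.mem_filter.1 hv).2
    have hf : W.filter (fun u => I.lab u = I.lab v) =
        (Finset.range I.n).filter fun u => I.lab u = I.lab v := by
      rw [hW, Finset.filter_filter]
      refine Finset.filter_congr fun u _ => and_iff_right_of_imp fun h => h ▸ hd
    rw [hf, ← I.components_lab.labelArcs_eq, ← Finset.card_eq_sum_ones]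
    exact hd.le
  have hsum := sum_multiDegree (U := W) (M := M) (fun a ha => by
    obtain ⟨ha, hd⟩ := Multiset.mem_filter.1 ha
    obtain ⟨h1, h2⟩ := I.lt_of_mem_ordinaryArcs ha
    simp only [hW, Finset.coe_filter, Set.mem_ofPred_eq, Finset.mem_range]
    exact ⟨⟨h1, (I.components_lab.label a ha) ▸ hd⟩, h2, hd⟩) .blue
  have hblue : (M.filter fun a => a.1 = .blue) = M :=
    Multiset.filter_eq_self.2 fun a ha => I.blue_of_mem a (Multiset.mem_of_mem_filter ha)
  rw [hblue] at hsum
  have hdeg : ∑ v ∈ W \ (endsOf I.specialArcs).toFinset, 3 ≤ ∑ v ∈ W, multiDegree M .blue v := by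
    refine (Finset.sum_le_sum fun v hv => ?_).trans
      (Finset.sum_le_sum_of_subset Finset.sdiff_subset)
    rw [Finset.mem_sdiff, List.mem_toFinset, hW, Finset.mem_filter, Finset.mem_range] at hv
    obtain ⟨⟨hv, hd⟩, hT⟩ := hv
    have h0 : ∀ c, multiDegree (I.specialArcs : Multiset (Arc ℕ)) c v = 0 :=
      multiDegree_eq_zero fun a ha => ⟨fun h => hT (mem_endsOf.2 ⟨a, ha, .inl h.symm⟩),
        fun h => hT (mem_endsOf.2 ⟨a, ha, .inr h.symm⟩)⟩
    have h3 := degree_of_isAndOr h hv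
    rw [I.multiDegree_arcList, I.multiDegree_arcList, h0, h0,
      multiDegree_red_eq_zero I.blue_of_mem] at h3
    rw [hM, multiDegree_filter]
    · omega
    · rintro a ha (rfl | rfl)
      · exact (I.components_lab.label a ha) ▸ hd
      · exact hd
  have hcard := Finset.card_le_card_sdiff_add_card (s := W) (t := (endsOf I.specialArcs).toFinset)
  rw [Finset.sum_const, smul_eq_mul] at hdeg
  rw [List.card_toFinset] at hcard
  omega

lemma length_pendants_le (h : I.G.IsAndOr) : I.pendants.length ≤ 10 * I.specialArcs.length := by
  classical
  have h1 : (endsOf I.specialArcs).dedup.length ≤ 2 * I.specialArcs.length := by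
    rw [← length_endsOf]
    exact (List.dedup_sublist _).length_le
  have h2 : ((endsOf I.specialArcs).dedup.flatMap (pendantArcs I.n I.ordinaryArcs
      (labels I.n I.ordinaryArcs))).length ≤ (endsOf I.specialArcs).dedup.length * 2 := by
    rw [List.length_flatMap]
    refine (List.sum_le_card_nsmul _ 2 fun k hk => ?_).trans (by simp)
    obtain ⟨t, -, rfl⟩ := List.mem_map.1 hk
    rw [pendantArcs_eq]
    split_ifs <;> simp
  have h3 := card_filter_isDef_le h
  rw [← Multiset.coe_card, coe_pendants, Multiset.card_add, Multiset.coe_card]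
  omega

end C2EInstance

lemma C2EAndOrByAndVertices_admitsLinearKernel : C2EAndOrByAndVertices.AdmitsLinearKernel := by
  -- With `s ≤ k' + 1` special arcs and at most `2 * s` terminals, at most `6 * s` arcs are kept and
  -- `4 * s` added. This makes at most `11 * s` edges and twice as many vertices.
  have h : ∀ I : {I : C2EInstance // I.G.IsAndOr}, ∃ J : {I : C2EInstance // I.G.IsAndOr},
      J.1.enc = Encoded.enc (kernelize pendantReplace (I.1.n, (I.1.e : ℕ), I.1.arcList)) ∧
      (J.1.Yes ↔ I.1.Yes) ∧ J.1.size ≤ 33 * (I.1.G.numAnd + 1) ∧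
      J.1.G.numAnd ≤ 33 * (I.1.G.numAnd + 1) := by
    rintro ⟨I, hI⟩
    obtain ⟨J, h1, h2, h3, h4⟩ := I.exists_enc_eq_kernelize pendantReplace (Q := I.pendants) rfl
      I.components_pendants I.feasOn_pendants I.hits_pendants
    obtain ⟨r, hr, -, hlen⟩ := I.exists_specialArcs_eq
    have hle := C2EInstance.numRed_le_numAnd hI
    have hs : I.specialArcs.length ≤ I.G.numAnd + 1 := by
      simp [hr]
      omega
    have hst := C2EInstance.length_pendants_le hI
    have hm : J.m = I.specialArcs.length + I.pendants.length := by
      rw [← J.length_arcList, h4]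
      simp
    have hn : J.n ≤ 2 * J.m := by
      rw [h3, hm, ← List.length_append, ← length_endsOf]
      exact (List.dedup_sublist _).length_le
    have hand : J.G.numAnd ≤ J.n := by
      rw [ConstraintGraph.numAnd]
      refine (Set.ncard_le_ncard (Set.subset_univ _)).trans ?_
      rw [Set.ncard_univ, Nat.card_fin]
    refine ⟨⟨J, C2EInstance.isAndOr_of_pendants hI h3 h4⟩, h1, h2, ?_, ?_⟩
    · change J.n + J.m ≤ 33 * (I.G.numAnd + 1)
      omega
    · change J.G.numAnd ≤ 33 * (I.G.numAnd + 1)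
      omega
  choose f h1 h2 h3 h4 using h
  exact ⟨f, polyTime_of_enc_eq_kernelize
    (Poly.pendantReplace Poly.id.fst Poly.id.snd.fst Poly.id.snd.snd) 
    (fun I : {I : C2EInstance // I.G.IsAndOr} => I.1) f h1, h2,
    fun k => 33 * (k + 1), isBigO_mul_add_one 33, fun I => ⟨h3 I, h4 I⟩⟩

end NCL

theorem corollary4 :
    NCL.C2EByRedEdges.AdmitsLinearKernel ∧ NCL.C2EAndOrByAndVertices.AdmitsLinearKernel :=
  ⟨NCL.C2EByRedEdges_admitsLinearKernel, NCL.C2EAndOrByAndVertices_admitsLinearKernel⟩
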